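/- Let $n\ge 1$, let $0\le \frac{\alpha}{2}\le \frac1n$, and put $$\varepsilon(t)=\frac1n-\Big(\frac1n-\frac{\alpha}{2}\Big)e^{-\alpha t}.$$ Consider smooth families of immersions $X:\mathbb{S}^n\times[0,T)\to\mathbb{R}^{n+1}$, $0<T\le\infty$, such that $X(\cdot,0)$ is an embedding, with smooth unit normal field $\nu$ that is outward at $t=0$ (hence, by continuity, the outward normal throughout). Let $g_{ij}$ be the induced metric, $h_{ij}=\langle\partial_i\nu,\partial_jX\rangle$ the second fundamental form and $H=g^{ij}h_{ij}$ the mean curvature of $X(\cdot,t)$. (a) Let $X$ solve the inverse mean curvature flow $\frac{\partial X}{\partial t}=\frac1H\nu$ on $\mathbb{S}^n\times[0,T)$ (in particular $H\neq0$ everywhere). If $H>0$ and $h_{ij}\ge\frac{\alpha}{2}Hg_{ij}$ at $t=0$, then $$h_{ij}\ge\varepsilon(t)\,H\,g_{ij}\qquad\text{for all } t\in[0,T),$$ and the rescaled hypersurfaces $\tilde X(\cdot,t)=e^{-t/n}X(\cdot,t)$ satisfy $\tilde h_{ij}\ge\varepsilon(t)\tilde H\tilde g_{ij}$ for all $t\in[0,T)$,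 where $\tilde g_{ij},\tilde h_{ij},\tilde H$ are the geometric quantities of $\tilde X$. (b) Let $\tilde X$ solve the rescaled flow $\frac{\partial\tilde X}{\partial t}=-\frac1n\tilde X+\frac1{\tilde H}\nu$ on $\mathbb{S}^n\times[0,T)$ (in particular $\tilde H\neq0$ everywhere). If $\tilde H>0$ and $\tilde h_{ij}\ge\frac{\alpha}{2}\tilde H\tilde g_{ij}$ at $t=0$, then $\tilde h_{ij}\ge\varepsilon(t)\tilde H\tilde g_{ij}$ for all $t\in[0,T)$. Inequalities between symmetric tensors are meant as inequalities of quadratic forms on each tangent space. -/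

import Mathlib

open scoped Manifold ContDiff Topology RealInnerProductSpace

noncomputable section

namespace IMCF

/-- Euclidean space `ℝ^(n+1)`. -/
abbrev Ambient (n : ℕ) : Type := EuclideanSpace ℝ (Fin (n + 1))

/-- The unit sphere `S^n` in `ℝ^(n+1)`, with its standard smooth structure. -/
abbrev Sph (n : ℕ) : Type := Metric.sphere (0 : Ambient n) 1

/-- The tangent space of `S^n` at `x`. -/
abbrev Tan {n : ℕ} (x : Sph n) : Type := TangentSpace (𝓡 n) x

/-- The differential at `x`, as a map `T_x S^n → ℝ^(n+1)`, of a map `F : S^n → ℝ^(n+1)`. -/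
def diff {n : ℕ} (F : Sph n → Ambient n) (x : Sph n) : Tan x →L[ℝ] Ambient n :=
  mvfderiv (𝓡 n) F x

/-- The first fundamental form (induced metric) `g(v, w) = ⟪dX v, dX w⟫`. -/
def firstForm {n : ℕ} (X : Sph n → Ambient n) (x : Sph n) (v w : Tan x) : ℝ :=
  ⟪diff X x v, diff X x w⟫

/-- The second fundamental form with respect to the unit normal field `ν`,
`h(v, w) = ⟪dν v, dX w⟫`. With this sign round spheres have `h > 0` for the outward normal. -/
def secondForm {n : ℕ} (X ν : Sph n → Ambient n) (x : Sph n) (v w : Tan x) : ℝ :=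
  ⟪diff ν x v, diff X x w⟫

/-- The `i`-th coordinate tangent vector at `x` (for the preferred chart at `x`). -/
def coordVec {n : ℕ} (x : Sph n) (i : Fin n) : Tan x :=
  (EuclideanSpace.single i (1 : ℝ) : EuclideanSpace ℝ (Fin n))

/-- The matrix `g_ij`. -/
def gMatrix {n : ℕ} (X : Sph n → Ambient n) (x : Sph n) : Matrix (Fin n) (Fin n) ℝ :=
  Matrix.of fun i j => firstForm X x (coordVec x i) (coordVec x j)

/-- The matrix `h_ij`. -/
def hMatrix {n : ℕ} (X ν : Sph n → Ambient n) (x : Sph n) : Matrix (Fin n) (Fin n) ℝ :=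
  Matrix.of fun i j => secondForm X ν x (coordVec x i) (coordVec x j)

/-- The mean curvature `H = g^{ij} h_ij`, where `(g^{ij})` is the inverse matrix of `(g_ij)`. -/
def meanCurv {n : ℕ} (X ν : Sph n → Ambient n) (x : Sph n) : ℝ :=
  ∑ i, ∑ j, (gMatrix X x)⁻¹ i j * hMatrix X ν x i j

/-- The pinching inequality `h_ij ≥ ε H g_ij` on the whole hypersurface, in the sense of quadratic
forms on every tangent space. -/
def Pinched {n : ℕ} (X ν : Sph n → Ambient n) (ε : ℝ) : Prop :=
  ∀ (x : Sph n) (v : Tan x), ε * meanCurv X ν x * firstForm X x v v ≤ secondForm X ν x v v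

/-- `ν` points out of the hypersurface `X(S^n)`: for all small `s > 0` the point `X(x) + s ν(x)`
lies in an unbounded connected component of the complement of `X(S^n)`. (Here
`connectedComponentIn` is empty, hence bounded, for a point of `X(S^n)` itself.) -/
def PointsOutward {n : ℕ} (X ν : Sph n → Ambient n) : Prop :=
  ∀ x : Sph n, ∀ᶠ s in 𝓝[>] (0 : ℝ),
    ¬ Bornology.IsBounded (connectedComponentIn (Set.range X)ᶜ (X x + s • ν x))

/-- The time interval `[0, T)`, where `T = ⊤` is allowed. -/
def timeInterval (T : EReal) : Set ℝ := {t : ℝ | 0 ≤ t ∧ (t : EReal) < T}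

/-- A smooth family of closed immersed hypersurfaces `X(·, t) : S^n → ℝ^(n+1)`, `t ∈ [0, T)`,
starting from an embedded one, together with its smooth unit normal field `ν`, which is the outward
one: it is outward for the embedded initial hypersurface and continuous in `t`. -/
structure IsHypersurfaceFamily {n : ℕ} (T : EReal) (X ν : ℝ → Sph n → Ambient n) : Prop where
  smooth : ContMDiffOn (𝓘(ℝ, ℝ).prod (𝓡 n)) 𝓘(ℝ, Ambient n) ∞
    (fun p : ℝ × Sph n => X p.1 p.2) (timeInterval T ×ˢ Set.univ)
  smooth_normal : ContMDiffOn (𝓘(ℝ, ℝ).prod (𝓡 n)) 𝓘(ℝ, Ambient n) ∞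
    (fun p : ℝ × Sph n => ν p.1 p.2) (timeInterval T ×ˢ Set.univ)
  immersion : ∀ t ∈ timeInterval T, ∀ x, Function.Injective (diff (X t) x)
  norm_normal : ∀ t ∈ timeInterval T, ∀ x, ‖ν t x‖ = 1
  normal : ∀ t ∈ timeInterval T, ∀ x, ∀ v : Tan x, ⟪ν t x, diff (X t) x v⟫ = 0
  embedded : Function.Injective (X 0)
  outward : PointsOutward (X 0) (ν 0)

/-- A smooth solution on `S^n × [0, T)` of the inverse mean curvature flow `∂X/∂t = (1/H) ν`. -/
structure IsSolution {n : ℕ} (T : EReal) (X ν : ℝ → Sph n → Ambient n) : Prop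
    extends IsHypersurfaceFamily T X ν where
  meanCurv_ne_zero : ∀ t ∈ timeInterval T, ∀ x, meanCurv (X t) (ν t) x ≠ 0
  flow : ∀ t ∈ timeInterval T, ∀ x,
    HasDerivWithinAt (fun s => X s x) ((1 / meanCurv (X t) (ν t) x) • ν t x) (timeInterval T) t

/-- A smooth solution on `S^n × [0, T)` of the rescaled inverse mean curvature flow
`∂X/∂t = -(1/n) X + (1/H) ν`. -/
structure IsRescaledSolution {n : ℕ} (T : EReal) (X ν : ℝ → Sph n → Ambient n) : Prop
    extends IsHypersurfaceFamily T X ν where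
  meanCurv_ne_zero : ∀ t ∈ timeInterval T, ∀ x, meanCurv (X t) (ν t) x ≠ 0
  flow : ∀ t ∈ timeInterval T, ∀ x,
    HasDerivWithinAt (fun s => X s x)
      (-(1 / (n : ℝ)) • X t x + (1 / meanCurv (X t) (ν t) x) • ν t x) (timeInterval T) t

/-- The rescaled family `X̃(·, t) = e^{-t/n} X(·, t)`. -/
def rescale {n : ℕ} (X : ℝ → Sph n → Ambient n) : ℝ → Sph n → Ambient n :=
  fun t x => Real.exp (-t / n) • X t x

/-- The pinching function `ε(t) = 1/n - (1/n - α/2) e^{-αt}`. -/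
def pinchFun (n : ℕ) (α t : ℝ) : ℝ :=
  1 / (n : ℝ) - (1 / (n : ℝ) - α / 2) * Real.exp (-α * t)

end IMCF

end

/-! ### Directional derivatives -/

noncomputable section

namespace IMCF

section DirectionalCalculus

variable {Z G : Type*} [NormedAddCommGroup Z] [NormedSpace ℝ Z]
  [NormedAddCommGroup G] [NormedSpace ℝ G]

/-! The proof is a tensor maximum principle for S = h - e H g, carried out in coordinates at one
point. Suppose S ≥ 0 up to time t₀ and S(w, w) = 0 for a unit vector w at some point. Near that
point X(·, t₀) is written as a graph over its tangent plane (`exists_graph_param`). The second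
derivatives on this slice, and the third derivatives at the base point, are then multiples of the
normal at the base point. Hence no Christoffel symbols appear there: the Codazzi equation is the
symmetry of third derivatives, and Simons' identity follows from the symmetry of fourth derivatives.

Three facts are combined. The vector w lies in the kernel of S (`null_vector`). S evaluated on w + γ
s bᵢ along the line s bᵢ has a minimum at s = 0, which is summed over an orthonormal basis
(`second_order_test`, `spatial_inequality`). The time derivative of S(w, w) is nonpositive and is
computed from the evolution equations of g, h and H (`time_inequality`). The Hessian of the speed
1/H contributes the bad gradient term -2 (∂_w H)² / H³. Taking γ = -∂_w H / H cancels it and leaves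
e b H with b ≥ 0. The outcome, `pinching_speed`, is 2e(A - e) + e b ≤ e' with A = |h|²/H² ≥ 1/n.

The function ε solves ε' = α(1/n - ε), and α ≤ 2ε makes it a subsolution of y' = 2y(1/n - y). To
obtain a strict contradiction, ε is replaced by ε - δ e^{Ct}, for which pinching is strict at t = 0,
and a first failure is excluded by `barrier_contradiction`. This perturbed factor may be negative;
upper bounds on A and b are then needed. The bound on b comes from a bound on ∂ν/∂t over a compact
time interval, since the tangential part of ∂ν/∂t is minus the gradient of 1/H. Finally δ → 0.

The rescaled statements follow because pinching is invariant under homotheties and e^{t/n} X̃ solves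
the unrescaled flow. -/

/-- The directional derivative of `f` in the constant direction `a`, as a function. -/
def dd (a : Z) (f : Z → G) (z : Z) : G := fderiv ℝ f z a

variable {Ω : Set Z}

theorem _root_.ContDiffOn.diffAt_of_isOpen {f : Z → G} (hf : ContDiffOn ℝ ∞ f Ω) (hΩ : IsOpen Ω)
    {z : Z} (hz : z ∈ Ω) : DifferentiableAt ℝ f z :=
  (hf.contDiffAt (hΩ.mem_nhds hz)).differentiableAt (by simp)

theorem smooth_dd {f : Z → G} (hΩ : IsOpen Ω) (hf : ContDiffOn ℝ ∞ f Ω) (a : Z) :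
    ContDiffOn ℝ ∞ (dd a f) Ω :=
  (hf.fderiv_of_isOpen hΩ (by simp)).clm_apply contDiffOn_const

theorem dd_congr {f g : Z → G} (hΩ : IsOpen Ω) (h : ∀ z ∈ Ω, f z = g z) (a : Z) :
    ∀ z ∈ Ω, dd a f z = dd a g z := fun z hz => by
  have : f =ᶠ[𝓝 z] g := Filter.eventuallyEq_of_mem (hΩ.mem_nhds hz) h
  simp [dd, this.fderiv_eq]

theorem dd_comm {f : Z → G} (hΩ : IsOpen Ω) (hf : ContDiffOn ℝ ∞ f Ω) (a b : Z) :
    ∀ z ∈ Ω, dd a (dd b f) z = dd b (dd a f) z := fun z hz => by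
  have hs : IsSymmSndFDerivAt ℝ f z :=
    (hf.contDiffAt (hΩ.mem_nhds hz)).isSymmSndFDerivAt (by simpa using ENat.LEInfty.out)
  have hd : DifferentiableAt ℝ (fderiv ℝ f) z :=
    (hf.fderiv_of_isOpen hΩ (m := ∞) (by simp)).diffAt_of_isOpen hΩ hz
  have key : ∀ a b : Z, dd a (dd b f) z = fderiv ℝ (fderiv ℝ f) z a b := fun a b => by
    have : HasFDerivAt (fun z => fderiv ℝ f z b) _ z :=
      hd.hasFDerivAt.clm_apply (hasFDerivAt_const b z)
    simp only [dd]
    change fderiv ℝ (fun z => fderiv ℝ f z b) z a = _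
    rw [this.fderiv]
    simp
  rw [key, key, hs.eq]

theorem dd_add {f g : Z → G} (hΩ : IsOpen Ω) (hf : ContDiffOn ℝ ∞ f Ω) (hg : ContDiffOn ℝ ∞ g Ω)
    (a : Z) : ∀ z ∈ Ω, dd a (fun z => f z + g z) z = dd a f z + dd a g z := fun z hz => by
  simp [dd, fderiv_fun_add (hf.diffAt_of_isOpen hΩ hz) (hg.diffAt_of_isOpen hΩ hz)]

theorem dd_sub {f g : Z → G} (hΩ : IsOpen Ω) (hf : ContDiffOn ℝ ∞ f Ω) (hg : ContDiffOn ℝ ∞ g Ω)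
    (a : Z) : ∀ z ∈ Ω, dd a (fun z => f z - g z) z = dd a f z - dd a g z := fun z hz => by
  simp [dd, fderiv_fun_sub (hf.diffAt_of_isOpen hΩ hz) (hg.diffAt_of_isOpen hΩ hz)]

theorem dd_neg (f : Z → G) (a : Z) (z : Z) : dd a (fun z => - f z) z = - dd a f z := by
  simp [dd, fderiv_fun_neg]

theorem dd_const (q : G) (a : Z) (z : Z) : dd a (fun _ => q) z = 0 := by simp [dd]

theorem dd_smul {f : Z → ℝ} {g : Z → G} (hΩ : IsOpen Ω) (hf : ContDiffOn ℝ ∞ f Ω)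
    (hg : ContDiffOn ℝ ∞ g Ω) (a : Z) :
    ∀ z ∈ Ω, dd a (fun z => f z • g z) z = dd a f z • g z + f z • dd a g z := fun z hz => by
  simp [dd, fderiv_fun_smul (hf.diffAt_of_isOpen hΩ hz) (hg.diffAt_of_isOpen hΩ hz), add_comm]

theorem dd_mul {f g : Z → ℝ} (hΩ : IsOpen Ω) (hf : ContDiffOn ℝ ∞ f Ω)
    (hg : ContDiffOn ℝ ∞ g Ω) (a : Z) :
    ∀ z ∈ Ω, dd a (fun z => f z * g z) z = dd a f z * g z + f z * dd a g z := fun z hz => by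
  simpa using dd_smul hΩ hf hg a z hz

theorem dd_sum {ι : Type*} (s : Finset ι) {f : ι → Z → G} (hΩ : IsOpen Ω)
    (hf : ∀ i, ContDiffOn ℝ ∞ (f i) Ω) (a : Z) :
    ∀ z ∈ Ω, dd a (fun z => ∑ i ∈ s, f i z) z = ∑ i ∈ s, dd a (f i) z := fun z hz => by
  simp [dd, fderiv_fun_sum (fun i _ => (hf i).diffAt_of_isOpen hΩ hz)]

theorem dd_dd_mul {f g : Z → ℝ} (hΩ : IsOpen Ω) (hf : ContDiffOn ℝ ∞ f Ω)
    (hg : ContDiffOn ℝ ∞ g Ω) (a : Z) : ∀ z ∈ Ω, dd a (dd a (fun z => f z * g z)) z =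
      dd a (dd a f) z * g z + 2 * (dd a f z * dd a g z) + f z * dd a (dd a g) z := fun z hz => by
  have hf' := smooth_dd hΩ hf a
  have hg' := smooth_dd hΩ hg a
  rw [dd_congr hΩ (dd_mul hΩ hf hg a) a z hz, dd_add hΩ (hf'.mul hg) (hf.mul hg') a z hz,
    dd_mul hΩ hf' hg a z hz, dd_mul hΩ hf hg' a z hz]
  ring

variable {E : Type*} [NormedAddCommGroup E] [InnerProductSpace ℝ E]

theorem dd_inner {f g : Z → E} (hΩ : IsOpen Ω) (hf : ContDiffOn ℝ ∞ f Ω)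
    (hg : ContDiffOn ℝ ∞ g Ω) (a : Z) :
    ∀ z ∈ Ω, dd a (fun z => ⟪f z, g z⟫) z = ⟪dd a f z, g z⟫ + ⟪f z, dd a g z⟫ := fun z hz => by
  simp only [dd]
  rw [fderiv_inner_apply ℝ (hf.diffAt_of_isOpen hΩ hz) (hg.diffAt_of_isOpen hΩ hz), add_comm]

theorem dd_dd_inner {f g : Z → E} (hΩ : IsOpen Ω) (hf : ContDiffOn ℝ ∞ f Ω)
    (hg : ContDiffOn ℝ ∞ g Ω) (a b : Z) : ∀ z ∈ Ω, dd b (dd a (fun z => ⟪f z, g z⟫)) z =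
      ⟪dd b (dd a f) z, g z⟫ + ⟪dd a f z, dd b g z⟫ + ⟪dd b f z, dd a g z⟫
        + ⟪f z, dd b (dd a g) z⟫ := fun z hz => by
  have hf' := smooth_dd hΩ hf a
  have hg' := smooth_dd hΩ hg a
  rw [dd_congr hΩ (dd_inner hΩ hf hg a) b z hz,
    dd_add hΩ (hf'.inner ℝ hg) (hf.inner ℝ hg') b z hz,
    dd_inner hΩ hf' hg b z hz, dd_inner hΩ hf hg' b z hz]
  ring

/-- Derivatives along a slice `{t₀} × V` only depend on the values on the slice. -/
theorem dd_congr_slice {V : Type*} [NormedAddCommGroup V] [NormedSpace ℝ V] {Ω : Set (ℝ × V)}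
    {f g : ℝ × V → G} (hΩ : IsOpen Ω) (hf : ContDiffOn ℝ ∞ f Ω) (hg : ContDiffOn ℝ ∞ g Ω)
    {t₀ : ℝ} (h : ∀ y, (t₀, y) ∈ Ω → f (t₀, y) = g (t₀, y)) (a : V) :
    ∀ y, (t₀, y) ∈ Ω → dd (0, a) f (t₀, y) = dd (0, a) g (t₀, y) := fun y hy => by
  have key : ∀ f : ℝ × V → G, ContDiffOn ℝ ∞ f Ω →
      dd (0, a) f (t₀, y) = fderiv ℝ (fun y => f (t₀, y)) y a := fun f hf => by
    have h1 : HasFDerivAt (fun y : V => (t₀, y)) (ContinuousLinearMap.inr ℝ ℝ V) y :=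
      hasFDerivAt_prodMk_right t₀ y
    have h2 := (hf.diffAt_of_isOpen hΩ hy).hasFDerivAt.comp y h1
    have h3 : fderiv ℝ (fun y => f (t₀, y)) y = _ := h2.fderiv
    rw [h3]; simp [dd]
  rw [key f hf, key g hg]
  have : (fun y => f (t₀, y)) =ᶠ[𝓝 y] (fun y => g (t₀, y)) := by
    have : (fun y : V => (t₀, y)) ⁻¹' Ω ∈ 𝓝 y :=
      (hΩ.preimage (by fun_prop)).mem_nhds hy
    filter_upwards [this] with y hy using h y hy
  rw [this.fderiv_eq]

/-- The derivative of `s ↦ f (z + s • a)`. -/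
theorem hasDerivAt_line {f : Z → G} (hΩ : IsOpen Ω) (hf : ContDiffOn ℝ ∞ f Ω) (z a : Z) (s : ℝ)
    (hz : z + s • a ∈ Ω) :
    HasDerivAt (fun s : ℝ => f (z + s • a)) (dd a f (z + s • a)) s := by
  have h1 : HasDerivAt (fun s : ℝ => z + s • a) a s := by
    simpa using ((hasDerivAt_id s).smul_const a).const_add z
  exact (hf.diffAt_of_isOpen hΩ hz).hasFDerivAt.comp_hasDerivAt s h1

end DirectionalCalculus

/-- Necessary second order condition at a local minimum. -/
theorem second_deriv_nonneg_of_isLocalMin {f f' : ℝ → ℝ} {c x : ℝ}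
    (hf : ∀ᶠ s in 𝓝 x, HasDerivAt f (f' s) s) (hf' : HasDerivAt f' c x) (h : IsLocalMin f x) :
    f' x = 0 ∧ 0 ≤ c := by
  have h0 : f' x = 0 := h.hasDerivAt_eq_zero hf.self_of_nhds
  refine ⟨h0, ?_⟩
  by_contra! hc
  have hd : deriv f =ᶠ[𝓝 x] f' := hf.mono fun s hs => hs.deriv
  have hdd : deriv (deriv f) x = c := by rw [hd.deriv_eq]; exact hf'.deriv
  -- A negative second derivative would make `x` a local maximum as well, so `f` would be constant
  -- near `x` and `c` would be zero.
  have hmax := isLocalMax_of_deriv_deriv_neg (by rw [hdd]; exact hc)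
    (by rw [hf.self_of_nhds.deriv]; exact h0) hf.self_of_nhds.continuousAt
  have hconst : f =ᶠ[𝓝 x] fun _ => f x := by
    filter_upwards [h, hmax] with s h1 h2 using le_antisymm h2 h1
  have h1 : deriv f =ᶠ[𝓝 x] fun _ => (0 : ℝ) := by
    have := hconst.deriv
    simpa using this
  rw [h1.deriv_eq] at hdd
  simp at hdd
  linarith

end IMCF
end

/-! ### Graphical parametrisations of moving hypersurfaces -/

noncomputable section

namespace IMCF

/-- The model space of an `n`-dimensional manifold. -/
abbrev Model (n : ℕ) : Type := EuclideanSpace ℝ (Fin n)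

/-- The standard basis vectors of the model space. -/
def bv {n : ℕ} (i : Fin n) : Model n := EuclideanSpace.single i 1

theorem inner_bv {n : ℕ} (i j : Fin n) : ⟪(bv i : Model n), bv j⟫ = if i = j then 1 else 0 := by
  simp [bv, EuclideanSpace.inner_single_left]

theorem inner_bv_right {n : ℕ} (v : Model n) (j : Fin n) : ⟪v, bv j⟫ = v j := by
  simp [bv, EuclideanSpace.inner_single_right]

/-- A moving hypersurface `F` with unit normal `N`, mean curvature `H` and Weingarten matrix `W`,
evolving by inverse mean curvature flow and parametrised on `Ω` in such a way that `F (t₀, ·)` is a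
graph over its tangent plane at the origin. -/
structure GraphFlow {n : ℕ} {E : Type*} [NormedAddCommGroup E] [InnerProductSpace ℝ E]
    (F N : ℝ × Model n → E) (H : ℝ × Model n → ℝ)
    (W : Fin n → Fin n → ℝ × Model n → ℝ)
    (Ω : Set (ℝ × Model n)) (t₀ : ℝ) : Prop where
  isOpen : IsOpen Ω
  mem : (t₀, 0) ∈ Ω
  smoothF : ContDiffOn ℝ ∞ F Ω
  smoothN : ContDiffOn ℝ ∞ N Ω
  smoothH : ContDiffOn ℝ ∞ H Ω
  smoothW : ∀ i j, ContDiffOn ℝ ∞ (W i j) Ω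
  norm : ∀ z ∈ Ω, ⟪N z, N z⟫ = 1
  normal : ∀ z ∈ Ω, ∀ a, ⟪N z, dd (0, a) F z⟫ = 0
  weingarten : ∀ z ∈ Ω, ∀ i, dd (0, bv i) N z =
    ∑ j, W i j z • dd (0, bv j) F z
  trace : ∀ z ∈ Ω, H z = ∑ i, W i i z
  pos : ∀ z ∈ Ω, 0 < H z
  flow : ∀ z ∈ Ω, dd (1, 0) F z = (H z)⁻¹ • N z
  isometric : ∀ a b, ⟪dd (0, a) F (t₀, 0), dd (0, b) F (t₀, 0)⟫ = ⟪a, b⟫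
  -- The tangent plane is the fixed one at the origin while `y` ranges over the slice, so this
  -- relation can be differentiated again in `y`.
  graph : ∀ y, (t₀, y) ∈ Ω → ∀ a b c,
    ⟪dd (0, b) (dd (0, a) F) (t₀, y), dd (0, c) F (t₀, 0)⟫ = 0
  -- This replaces the dimension count that the normal and the tangent plane fill `E`.
  span : ∀ q : E, ⟪q, N (t₀, 0)⟫ = 0 → (∀ a, ⟪q, dd (0, a) F (t₀, 0)⟫ = 0) → q = 0

namespace GraphFlow

variable {n : ℕ} {E : Type*} [NormedAddCommGroup E] [InnerProductSpace ℝ E]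
  {F N : ℝ × Model n → E} {H : ℝ × Model n → ℝ}
  {W : Fin n → Fin n → ℝ × Model n → ℝ}
  {Ω : Set (ℝ × Model n)} {t₀ : ℝ}

section
variable (D : GraphFlow F N H W Ω t₀)
include D

theorem inner_dd_normal (a : ℝ × Model n) : ∀ z ∈ Ω, ⟪dd a N z, N z⟫ = 0 := fun z hz => by
  have h := dd_congr D.isOpen D.norm a z hz
  rw [dd_inner D.isOpen D.smoothN D.smoothN a z hz, dd_const, real_inner_comm] at h
  rw [real_inner_comm]
  linarith

theorem inner_dd_dd_normal (a b : ℝ × Model n) :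
    ∀ z ∈ Ω, ⟪dd b (dd a N) z, N z⟫ = - ⟪dd a N z, dd b N z⟫ := fun z hz => by
  have h := dd_congr D.isOpen (D.inner_dd_normal a) b z hz
  rw [dd_inner D.isOpen (smooth_dd D.isOpen D.smoothN a) D.smoothN b z hz, dd_const] at h
  linarith

theorem smoothF1 (a : ℝ × Model n) : ContDiffOn ℝ ∞ (dd a F) Ω := smooth_dd D.isOpen D.smoothF a
theorem smoothN1 (a : ℝ × Model n) : ContDiffOn ℝ ∞ (dd a N) Ω := smooth_dd D.isOpen D.smoothN a
theorem smoothF2 (a b : ℝ × Model n) : ContDiffOn ℝ ∞ (dd b (dd a F)) Ω :=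
  smooth_dd D.isOpen (D.smoothF1 a) b

theorem inner_normal_derivative (a : Model n) (b : ℝ × Model n) : ∀ z ∈ Ω,
    ⟪dd b N z, dd (0, a) F z⟫ = - ⟪N z, dd b (dd (0, a) F) z⟫ := fun z hz => by
  have h := dd_congr D.isOpen (fun z hz => D.normal z hz a) b z hz
  rw [dd_inner D.isOpen D.smoothN (D.smoothF1 _) b z hz, dd_const] at h
  linarith

/-- The second derivatives of a graph at the base point are normal. -/
theorem second_derivative_eq (a b : Model n) {y : Model n} (hy : (t₀, y) ∈ Ω) :
    dd (0, b) (dd (0, a) F) (t₀, y) =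
      ⟪dd (0, b) (dd (0, a) F) (t₀, y), N (t₀, 0)⟫ • N (t₀, 0) := by
  rw [← sub_eq_zero]
  apply D.span
  · rw [inner_sub_left, real_inner_smul_left, D.norm _ D.mem]; ring
  · intro c
    rw [inner_sub_left, real_inner_smul_left, D.graph y hy, D.normal _ D.mem]; ring

/-- The direction `N (t₀, 0)` is constant along the slice, so differentiating `second_derivative_eq`
in `y` stays in that direction. -/
theorem third_derivative_eq (a b c : Model n) :
    dd (0, c) (dd (0, b) (dd (0, a) F)) (t₀, 0) =
      ⟪dd (0, c) (dd (0, b) (dd (0, a) F)) (t₀, 0), N (t₀, 0)⟫ • N (t₀, 0) := by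
  have hs := D.smoothF2 (0, a) (0, b)
  have hs' : ContDiffOn ℝ ∞ (fun z => ⟪dd (0, b) (dd (0, a) F) z, N (t₀, 0)⟫) Ω :=
    hs.inner ℝ contDiffOn_const
  have h := dd_congr_slice D.isOpen hs
    (g := fun z => ⟪dd (0, b) (dd (0, a) F) z, N (t₀, 0)⟫ • N (t₀, 0))
    (hs'.smul contDiffOn_const) (fun y hy => D.second_derivative_eq a b hy) c 0 D.mem
  rw [dd_smul D.isOpen hs' contDiffOn_const _ _ D.mem,
    dd_inner D.isOpen hs contDiffOn_const _ _ D.mem, dd_const] at h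
  simpa using h

theorem inner_second_derivative {q : E} (hq : ⟪q, N (t₀, 0)⟫ = 0) (a b : Model n) :
    ⟪q, dd (0, b) (dd (0, a) F) (t₀, 0)⟫ = 0 := by
  rw [D.second_derivative_eq a b D.mem, real_inner_smul_right, hq, mul_zero]

theorem inner_third_derivative {q : E} (hq : ⟪q, N (t₀, 0)⟫ = 0) (a b c : Model n) :
    ⟪q, dd (0, c) (dd (0, b) (dd (0, a) F)) (t₀, 0)⟫ = 0 := by
  rw [D.third_derivative_eq a b c, real_inner_smul_right, hq, mul_zero]

theorem inner_tangent_normal (a : Model n) : ⟪dd (0, a) F (t₀, 0), N (t₀, 0)⟫ = 0 := by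
  rw [real_inner_comm]; exact D.normal _ D.mem a

end

/-- The second fundamental form in coordinates. -/
def sff (F N : ℝ × Model n → E) (a b : Model n) (z : ℝ × Model n) : ℝ := - ⟪N z, dd (0, b) (dd (0, a) F) z⟫

section
variable (D : GraphFlow F N H W Ω t₀)
include D

theorem smooth_sff (a b : Model n) : ContDiffOn ℝ ∞ (sff F N a b) Ω :=
  (D.smoothN.inner ℝ (D.smoothF2 _ _)).neg

theorem sff_comm (a b : Model n) : ∀ z ∈ Ω, sff F N a b z = sff F N b a z := fun z hz => by
  simp only [sff]; rw [dd_comm D.isOpen D.smoothF _ _ z hz]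

theorem sff_eq (a b : Model n) : ∀ z ∈ Ω, ⟪dd (0, b) N z, dd (0, a) F z⟫ = sff F N a b z :=
  D.inner_normal_derivative a (0, b)

theorem dd_sff (a b : Model n) (c : ℝ × Model n) : ∀ z ∈ Ω, dd c (sff F N a b) z =
    - ⟪dd c N z, dd (0, b) (dd (0, a) F) z⟫ - ⟪N z, dd c (dd (0, b) (dd (0, a) F)) z⟫ :=
    fun z hz => by
  have : dd c (sff F N a b) z = - dd c (fun z => ⟪N z, dd (0, b) (dd (0, a) F) z⟫) z :=
    dd_neg _ _ _
  rw [this, dd_inner D.isOpen D.smoothN (D.smoothF2 _ _) c z hz]; ring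

/-- The third derivatives at the base point: the covariant derivative of the second fundamental
form. -/
theorem dd_sff_base (a b c : Model n) : dd (0, c) (sff F N a b) (t₀, 0) =
    - ⟪N (t₀, 0), dd (0, c) (dd (0, b) (dd (0, a) F)) (t₀, 0)⟫ := by
  rw [D.dd_sff _ _ _ _ D.mem, D.inner_second_derivative (D.inner_dd_normal _ _ D.mem)]; ring

/-- At the base point the derivative of h is purely a third derivative of `F`, and third derivatives
commute. -/
theorem codazzi (a b c : Model n) :
    dd (0, c) (sff F N a b) (t₀, 0) = dd (0, b) (sff F N a c) (t₀, 0) := by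
  rw [D.dd_sff_base, D.dd_sff_base, dd_comm D.isOpen (D.smoothF1 _) _ _ _ D.mem]

theorem dd_sff_swap (a b c : Model n) :
    dd (0, c) (sff F N a b) (t₀, 0) = dd (0, c) (sff F N b a) (t₀, 0) :=
  dd_congr D.isOpen (D.sff_comm a b) _ _ D.mem

/-- The mixed terms pair a tangential derivative of the normal with a normal third derivative and
vanish. The second derivative of the normal enters only through its normal component, which is -|∂_c
N|². -/
theorem dd_dd_sff_base (a b c : Model n) : dd (0, c) (dd (0, c) (sff F N a b)) (t₀, 0) =
    - ⟪N (t₀, 0), dd (0, c) (dd (0, c) (dd (0, b) (dd (0, a) F))) (t₀, 0)⟫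
      - ⟪dd (0, c) N (t₀, 0), dd (0, c) N (t₀, 0)⟫ * sff F N a b (t₀, 0) := by
  have h1 : dd (0, c) (dd (0, c) (sff F N a b)) (t₀, 0) =
      - dd (0, c) (dd (0, c) (fun z => ⟪N z, dd (0, b) (dd (0, a) F) z⟫)) (t₀, 0) := by
    have : dd (0, c) (sff F N a b) = fun z =>
      - dd (0, c) (fun z => ⟪N z, dd (0, b) (dd (0, a) F) z⟫) z := funext fun z => dd_neg _ _ _
    rw [this, dd_neg]
  rw [h1, dd_dd_inner D.isOpen D.smoothN (D.smoothF2 _ _) _ _ _ D.mem,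
    D.inner_third_derivative (D.inner_dd_normal _ _ D.mem)]
  rw [D.second_derivative_eq a b D.mem, real_inner_smul_right, D.inner_dd_dd_normal _ _ _ D.mem]
  simp only [sff]
  rw [real_inner_comm (N (t₀, 0)) (dd (0, b) (dd (0, a) F) (t₀, 0))]
  ring

/-- A symmetry of the fourth derivatives. -/
theorem fourth_derivative_comm (a c : Model n) :
    dd (0, c) (dd (0, c) (dd (0, a) (dd (0, a) F))) (t₀, 0) =
      dd (0, a) (dd (0, a) (dd (0, c) (dd (0, c) F))) (t₀, 0) := by
  have hO := D.isOpen
  have h1 : ∀ z ∈ Ω, dd (0, c) (dd (0, a) (dd (0, a) F)) z =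
      dd (0, a) (dd (0, a) (dd (0, c) F)) z := fun z hz => by
    rw [dd_comm hO (D.smoothF1 _) _ _ z hz]
    exact dd_congr hO (dd_comm hO D.smoothF _ _) _ z hz
  rw [dd_congr hO h1 _ _ D.mem, dd_comm hO (D.smoothF2 _ _) _ _ _ D.mem]
  refine dd_congr hO (fun z hz => ?_) _ _ D.mem
  rw [dd_comm hO (D.smoothF1 _) _ _ z hz]

/-- The first derivatives of the metric vanish at the base point. -/
theorem dd_metric_base (a b c : Model n) :
    dd (0, c) (fun z => ⟪dd (0, a) F z, dd (0, b) F z⟫) (t₀, 0) = 0 := by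
  rw [dd_inner D.isOpen (D.smoothF1 _) (D.smoothF1 _) _ _ D.mem,
    D.inner_second_derivative (D.inner_tangent_normal a), real_inner_comm,
    D.inner_second_derivative (D.inner_tangent_normal b), add_zero]

theorem inner_second_second (a b c d : Model n) :
    ⟪dd (0, b) (dd (0, a) F) (t₀, 0), dd (0, d) (dd (0, c) F) (t₀, 0)⟫ =
      sff F N a b (t₀, 0) * sff F N c d (t₀, 0) := by
  rw [D.second_derivative_eq a b D.mem, real_inner_smul_left, sff, sff, real_inner_comm]; ring

/-- Third derivatives have no tangential part, so only products of second derivatives survive. For a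
graph of u this is the second derivative of g = δ + du ⊗ du, and it carries the curvature. -/
theorem dd_dd_metric_base (a c : Model n) :
    dd (0, c) (dd (0, c) (fun z => ⟪dd (0, a) F z, dd (0, a) F z⟫)) (t₀, 0) =
      2 * sff F N a c (t₀, 0) ^ 2 := by
  rw [dd_dd_inner D.isOpen (D.smoothF1 _) (D.smoothF1 _) _ _ _ D.mem,
    D.inner_third_derivative (D.inner_tangent_normal a), real_inner_comm,
    D.inner_third_derivative (D.inner_tangent_normal a), D.inner_second_second]
  ring

theorem weingarten_base (i j : Fin n) : W i j (t₀, 0) = sff F N (bv i) (bv j) (t₀, 0) := by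
  rw [D.sff_comm _ _ _ D.mem, ← D.sff_eq _ _ _ D.mem, D.weingarten _ D.mem, sum_inner]
  simp only [real_inner_smul_left, D.isometric, inner_bv]
  simp

theorem dd_normal_base_inner (i : Fin n) (q : E) :
    ⟪dd (0, bv i) N (t₀, 0), q⟫ =
      ∑ j, sff F N (bv i) (bv j) (t₀, 0) * ⟪dd (0, bv j) F (t₀, 0), q⟫ := by
  rw [D.weingarten _ D.mem, sum_inner]
  simp only [real_inner_smul_left, D.weingarten_base]

theorem dd_trace (c : ℝ × Model n) : ∀ z ∈ Ω, dd c H z = ∑ i, dd c (W i i) z := fun z hz => by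
  rw [dd_congr D.isOpen D.trace c z hz, dd_sum _ D.isOpen (fun i => D.smoothW i i) c z hz]

theorem dd_weingarten (c : ℝ × Model n) (i : Fin n) : ∀ z ∈ Ω, dd c (dd (0, bv i) N) z =
    ∑ j, (dd c (W i j) z • dd (0, bv j) F z + W i j z • dd c (dd (0, bv j) F) z) :=
    fun z hz => by
  rw [dd_congr D.isOpen (fun z hz => D.weingarten z hz i) c z hz,
    dd_sum _ (f := fun j z => W i j z • dd (0, bv j) F z) D.isOpen
      (fun j => (D.smoothW i j).smul (D.smoothF1 _)) c z hz]
  refine Finset.sum_congr rfl fun j _ => ?_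
  rw [dd_smul D.isOpen (D.smoothW i j) (D.smoothF1 _) c z hz]

theorem dd_weingarten_base (c : Model n) (i : Fin n) : dd (0, c) (W i i) (t₀, 0) =
    ⟪dd (0, c) (dd (0, bv i) N) (t₀, 0), dd (0, bv i) F (t₀, 0)⟫ := by
  rw [D.dd_weingarten _ _ _ D.mem, sum_inner]
  simp only [inner_add_left, real_inner_smul_left, D.isometric, D.graph 0 D.mem, inner_bv]
  simp

/-- Spatial derivatives of the frame are normal at the base point, so differentiating the
coefficients alone already gives the tangential component. -/
theorem dd_dd_weingarten_base (c : Model n) (i : Fin n) : dd (0, c) (dd (0, c) (W i i)) (t₀, 0) =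
    ⟪dd (0, c) (dd (0, c) (dd (0, bv i) N)) (t₀, 0), dd (0, bv i) F (t₀, 0)⟫ := by
  have hW := fun j => smooth_dd D.isOpen (D.smoothW i j) (0, c)
  rw [dd_congr D.isOpen (D.dd_weingarten (0, c) i) _ _ D.mem,
    dd_sum _ (f := fun j z => dd (0, c) (W i j) z • dd (0, bv j) F z +
      W i j z • dd (0, c) (dd (0, bv j) F) z) D.isOpen (fun j => ((hW j).smul (D.smoothF1 _)).add
      ((D.smoothW i j).smul (D.smoothF2 _ _))) _ _ D.mem, sum_inner]
  have : ∀ j, ⟪dd (0, c) (fun z => dd (0, c) (W i j) z • dd (0, bv j) F z +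
      W i j z • dd (0, c) (dd (0, bv j) F) z) (t₀, 0), dd (0, bv i) F (t₀, 0)⟫ =
      dd (0, c) (dd (0, c) (W i j)) (t₀, 0) * ⟪bv j, bv i⟫ := fun j => by
    rw [dd_add (f := fun z => dd (0, c) (W i j) z • dd (0, bv j) F z)
      (g := fun z => W i j z • dd (0, c) (dd (0, bv j) F) z) D.isOpen ((hW j).smul (D.smoothF1 _)) ((D.smoothW i j).smul (D.smoothF2 _ _)) _ _
      D.mem, dd_smul D.isOpen (hW j) (D.smoothF1 _) _ _ D.mem,
      dd_smul D.isOpen (D.smoothW i j) (D.smoothF2 _ _) _ _ D.mem]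
    have h3 : ⟪dd (0, c) (dd (0, c) (dd (0, bv j) F)) (t₀, 0), dd (0, bv i) F (t₀, 0)⟫ = 0 := by
      rw [real_inner_comm, D.inner_third_derivative (D.inner_tangent_normal _)]
    simp only [inner_add_left, real_inner_smul_left, D.isometric, D.graph 0 D.mem, h3]
    ring
  simp only [this, inner_bv]
  simp

/-- The frame does move tangentially in time; this gives the correction that is absent from the
spatial formula `dd_weingarten_base`. -/
theorem dd_time_weingarten_base (i : Fin n) : dd (1, 0) (W i i) (t₀, 0) =
    ⟪dd (1, 0) (dd (0, bv i) N) (t₀, 0), dd (0, bv i) F (t₀, 0)⟫ -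
      ∑ j, W i j (t₀, 0) * ⟪dd (1, 0) (dd (0, bv j) F) (t₀, 0), dd (0, bv i) F (t₀, 0)⟫ := by
  rw [D.dd_weingarten _ _ _ D.mem, sum_inner]
  simp only [inner_add_left, real_inner_smul_left, D.isometric, inner_bv, Finset.sum_add_distrib]
  simp

/-- The gradient of the mean curvature. -/
theorem dd_meanCurv_base (c : Model n) :
    dd (0, c) H (t₀, 0) = ∑ i, dd (0, c) (sff F N (bv i) (bv i)) (t₀, 0) := by
  rw [D.dd_trace _ _ D.mem]
  refine Finset.sum_congr rfl fun i _ => ?_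
  rw [D.dd_weingarten_base]
  have h := dd_congr D.isOpen (D.sff_eq (bv i) (bv i)) (0, c) _ D.mem
  rw [dd_inner D.isOpen (D.smoothN1 _) (D.smoothF1 _) _ _ D.mem,
    D.inner_second_derivative (D.inner_dd_normal _ _ D.mem)] at h
  linarith

/-- The second derivatives of the mean curvature at the base point. -/
theorem dd_dd_meanCurv_base (c : Model n) : dd (0, c) (dd (0, c) H) (t₀, 0) =
    ∑ i, (dd (0, c) (dd (0, c) (sff F N (bv i) (bv i))) (t₀, 0) -
      2 * (sff F N (bv i) c (t₀, 0) * ⟪dd (0, bv i) N (t₀, 0), dd (0, c) N (t₀, 0)⟫)) := by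
  rw [dd_congr D.isOpen (D.dd_trace _) _ _ D.mem,
    dd_sum _ D.isOpen (fun i => smooth_dd D.isOpen (D.smoothW i i) _) _ _ D.mem]
  refine Finset.sum_congr rfl fun i _ => ?_
  rw [D.dd_dd_weingarten_base]
  have h : dd (0, c) (dd (0, c) (fun z => ⟪dd (0, bv i) N z, dd (0, bv i) F z⟫)) (t₀, 0) =
      dd (0, c) (dd (0, c) (sff F N (bv i) (bv i))) (t₀, 0) :=
    dd_congr D.isOpen (dd_congr D.isOpen (D.sff_eq (bv i) (bv i)) (0, c)) _ _ D.mem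
  rw [dd_dd_inner D.isOpen (D.smoothN1 _) (D.smoothF1 _) _ _ _ D.mem,
    D.inner_third_derivative (D.inner_dd_normal _ _ D.mem),
    D.second_derivative_eq (bv i) c D.mem, real_inner_smul_right,
    D.inner_dd_dd_normal _ _ _ D.mem] at h
  have h2 : ⟪dd (0, c) (dd (0, bv i) F) (t₀, 0), N (t₀, 0)⟫ = - sff F N (bv i) c (t₀, 0) := by
    rw [sff, real_inner_comm]; ring
  rw [h2] at h
  linarith

end

end GraphFlow

end IMCF
end

/-! ### Evolution equations at the base point -/

noncomputable section

namespace IMCF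

namespace GraphFlow

variable {n : ℕ} {E : Type*} [NormedAddCommGroup E] [InnerProductSpace ℝ E]
  {F N : ℝ × Model n → E} {H : ℝ × Model n → ℝ}
  {W : Fin n → Fin n → ℝ × Model n → ℝ}
  {Ω : Set (ℝ × Model n)} {t₀ : ℝ}

/-- Directional derivatives are linear in the direction. -/
theorem dd_eq_sum {G : Type*} [NormedAddCommGroup G] [NormedSpace ℝ G] (f : ℝ × Model n → G)
    (w : Model n) (z : ℝ × Model n) : dd (0, w) f z = ∑ i, w i • dd (0, bv i) f z := by
  have hw : ((0 : ℝ), w) = ∑ i, w i • ((0 : ℝ), (bv i : Model n)) := by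
    apply Prod.ext
    · simp [Prod.fst_sum]
    · simp only [Prod.snd_sum, Prod.smul_snd]
      have := (EuclideanSpace.basisFun (Fin n) ℝ).sum_repr w
      simpa [bv] using this.symm
  simp only [dd]
  rw [hw, map_sum]
  simp only [map_smul]

variable (D : GraphFlow F N H W Ω t₀)
include D

theorem smooth_inv : ContDiffOn ℝ ∞ (fun z => (H z)⁻¹) Ω :=
  D.smoothH.inv fun z hz => (D.pos z hz).ne'

theorem dd_inv (a : ℝ × Model n) : ∀ z ∈ Ω,
    dd a (fun z => (H z)⁻¹) z = - dd a H z / H z ^ 2 := fun z hz => by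
  have h := dd_congr D.isOpen
    (fun z hz => mul_inv_cancel₀ (D.pos z hz).ne' : ∀ z ∈ Ω, H z * (H z)⁻¹ = 1) a z hz
  rw [dd_mul D.isOpen D.smoothH D.smooth_inv a z hz, dd_const] at h
  have := (D.pos z hz).ne'
  field_simp at h ⊢
  linarith

theorem dd_dd_inv (a : ℝ × Model n) : ∀ z ∈ Ω, dd a (dd a (fun z => (H z)⁻¹)) z =
    - dd a (dd a H) z / H z ^ 2 + 2 * dd a H z ^ 2 / H z ^ 3 := fun z hz => by
  have h := dd_congr D.isOpen (dd_congr D.isOpen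
    (fun z hz => mul_inv_cancel₀ (D.pos z hz).ne' : ∀ z ∈ Ω, H z * (H z)⁻¹ = 1) a) a z hz
  rw [dd_dd_mul D.isOpen D.smoothH D.smooth_inv a z hz, D.dd_inv a z hz] at h
  have h0 : dd a (dd a fun _ : ℝ × Model n => (1 : ℝ)) z = 0 := by
    have : dd a (fun _ : ℝ × Model n => (1 : ℝ)) = fun _ => 0 := funext fun z => dd_const _ _ _
    rw [this, dd_const]
  rw [h0] at h
  have := (D.pos z hz).ne'
  field_simp at h ⊢
  linarith

/-- The time derivative of a tangent vector. -/
theorem dd_time_tangent (a : Model n) : ∀ z ∈ Ω, dd (1, 0) (dd (0, a) F) z =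
    dd (0, a) (fun z => (H z)⁻¹) z • N z + (H z)⁻¹ • dd (0, a) N z := fun z hz => by
  rw [dd_comm D.isOpen D.smoothF _ _ z hz, dd_congr D.isOpen D.flow _ z hz,
    dd_smul D.isOpen D.smooth_inv D.smoothN _ z hz]

/-- Commuting derivatives turns the left side into the normal part of the second derivative of f N,
where f = 1/H is the speed. -/
theorem inner_normal_dd_time_dd_tangent (a : Model n) : ∀ z ∈ Ω,
    ⟪N z, dd (1, 0) (dd (0, a) (dd (0, a) F)) z⟫ =
      dd (0, a) (dd (0, a) (fun z => (H z)⁻¹)) z -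
        (H z)⁻¹ * ⟪dd (0, a) N z, dd (0, a) N z⟫ := fun z hz => by
  have hf := smooth_dd D.isOpen D.smooth_inv (0, a)
  rw [dd_comm D.isOpen (D.smoothF1 _) _ _ z hz, dd_congr D.isOpen (D.dd_time_tangent a) _ z hz,
    dd_add (f := fun z => dd (0, a) (fun z => (H z)⁻¹) z • N z)
      (g := fun z => (H z)⁻¹ • dd (0, a) N z) D.isOpen (hf.smul D.smoothN)
      (D.smooth_inv.smul (D.smoothN1 _)) _ z hz,
    dd_smul D.isOpen hf D.smoothN _ z hz, dd_smul D.isOpen D.smooth_inv (D.smoothN1 _) _ z hz]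
  have h1 : ⟪N z, dd (0, a) N z⟫ = 0 := by
    rw [real_inner_comm]; exact D.inner_dd_normal _ z hz
  have h2 : ⟪N z, dd (0, a) (dd (0, a) N) z⟫ = - ⟪dd (0, a) N z, dd (0, a) N z⟫ := by
    rw [real_inner_comm]; exact D.inner_dd_dd_normal _ _ z hz
  simp only [inner_add_right, real_inner_smul_right, h1, h2, D.norm z hz]
  ring

/-- The evolution of the normal. -/
theorem inner_dd_time_normal (a : Model n) : ∀ z ∈ Ω,
    ⟪dd (1, 0) N z, dd (0, a) F z⟫ = - dd (0, a) (fun z => (H z)⁻¹) z := fun z hz => by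
  rw [D.inner_normal_derivative a (1, 0) z hz, D.dd_time_tangent a z hz, inner_add_right,
    real_inner_smul_right, real_inner_smul_right, D.norm z hz, real_inner_comm,
    D.inner_dd_normal _ z hz]
  ring

/-- The evolution of the second fundamental form. -/
theorem dd_time_sff_base (a : Model n) : dd (1, 0) (sff F N a a) (t₀, 0) =
    - dd (0, a) (dd (0, a) (fun z => (H z)⁻¹)) (t₀, 0) +
        (H (t₀, 0))⁻¹ * ⟪dd (0, a) N (t₀, 0), dd (0, a) N (t₀, 0)⟫ := by
  rw [D.dd_sff _ _ _ _ D.mem, D.inner_second_derivative (D.inner_dd_normal _ _ D.mem),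
    D.inner_normal_dd_time_dd_tangent a _ D.mem]
  ring

theorem inner_dd_time_tangent_base (a b : Model n) :
    ⟪dd (1, 0) (dd (0, a) F) (t₀, 0), dd (0, b) F (t₀, 0)⟫ =
      (H (t₀, 0))⁻¹ * sff F N a b (t₀, 0) := by
  rw [D.dd_time_tangent _ _ D.mem, inner_add_left, real_inner_smul_left, real_inner_smul_left,
    D.normal _ D.mem, D.sff_eq _ _ _ D.mem, D.sff_comm _ _ _ D.mem]
  ring

/-- The squared norm of the second fundamental form at the base point. -/
theorem inner_dd_normal_base (i j : Fin n) :
    ⟪dd (0, bv i) N (t₀, 0), dd (0, bv j) N (t₀, 0)⟫ =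
      ∑ k, sff F N (bv i) (bv k) (t₀, 0) * sff F N (bv j) (bv k) (t₀, 0) := by
  rw [D.dd_normal_base_inner]
  refine Finset.sum_congr rfl fun k _ => ?_
  rw [real_inner_comm, D.sff_eq _ _ _ D.mem, D.sff_comm (bv k) (bv j) _ D.mem]

/-- The evolution of the mean curvature. -/
theorem dd_time_meanCurv_base : dd (1, 0) H (t₀, 0) =
    - ∑ i, dd (0, bv i) (dd (0, bv i) (fun z => (H z)⁻¹)) (t₀, 0) -
      (H (t₀, 0))⁻¹ * ∑ i, ∑ j, sff F N (bv i) (bv j) (t₀, 0) ^ 2 := by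
  rw [D.dd_trace _ _ D.mem, ← Finset.sum_neg_distrib, Finset.mul_sum, ← Finset.sum_sub_distrib]
  refine Finset.sum_congr rfl fun i _ => ?_
  rw [D.dd_time_weingarten_base]
  have h := dd_congr D.isOpen (D.sff_eq (bv i) (bv i)) (1, 0) _ D.mem
  rw [dd_inner D.isOpen (D.smoothN1 _) (D.smoothF1 _) _ _ D.mem, D.dd_time_sff_base,
    D.dd_time_tangent _ _ D.mem, inner_add_right, real_inner_smul_right, real_inner_smul_right,
    D.inner_dd_normal _ _ D.mem] at h
  have h2 : ∑ j, W i j (t₀, 0) * ⟪dd (1, 0) (dd (0, bv j) F) (t₀, 0), dd (0, bv i) F (t₀, 0)⟫ =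
      (H (t₀, 0))⁻¹ * ∑ j, sff F N (bv i) (bv j) (t₀, 0) ^ 2 := by
    rw [Finset.mul_sum]
    refine Finset.sum_congr rfl fun j _ => ?_
    rw [D.inner_dd_time_tangent_base, D.weingarten_base, D.sff_comm (bv j) _ _ D.mem]; ring
  rw [h2]
  linarith

theorem meanCurv_base : H (t₀, 0) = ∑ i, sff F N (bv i) (bv i) (t₀, 0) := by
  rw [D.trace _ D.mem]; simp only [D.weingarten_base]

end GraphFlow

end IMCF
end

/-! ### The second order test -/

noncomputable section

namespace IMCF

theorem deriv_nonpos_of_nonneg_left {f : ℝ → ℝ} {c x : ℝ} (hf : HasDerivAt f c x)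
    (h : ∀ᶠ s in 𝓝[<] x, f x ≤ f s) : c ≤ 0 := by
  have h1 := hf.tendsto_slope.mono_left (nhdsWithin_mono x (s := Set.Iio x) fun s hs => ne_of_lt hs)
  refine le_of_tendsto h1 ?_
  filter_upwards [h, self_mem_nhdsWithin] with s hs hlt
  rw [slope_def_field]
  exact div_nonpos_of_nonneg_of_nonpos (by linarith) (by linarith [Set.mem_Iio.1 hlt])

theorem eq_zero_of_forall_quadratic_nonneg {p q : ℝ} (h : ∀ s : ℝ, 0 ≤ s * p + s ^ 2 * q) :
    p = 0 := by
  have hd := discrim_le_zero (a := q) (b := p) (c := 0) fun s => by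
    have := h s; nlinarith
  rw [discrim] at hd
  nlinarith [sq_nonneg p]

namespace GraphFlow

variable {n : ℕ} {E : Type*} [NormedAddCommGroup E] [InnerProductSpace ℝ E]
  {F N : ℝ × Model n → E} {H : ℝ × Model n → ℝ}
  {W : Fin n → Fin n → ℝ × Model n → ℝ}
  {Ω : Set (ℝ × Model n)} {t₀ : ℝ}

theorem dd_add_smul {G : Type*} [NormedAddCommGroup G] [NormedSpace ℝ G] (f : ℝ × Model n → G)
    (a b : Model n) (s : ℝ) (z : ℝ × Model n) :
    dd (0, a + s • b) f z = dd (0, a) f z + s • dd (0, b) f z := by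
  have : ((0 : ℝ), a + s • b) = (0, a) + s • (0, b) := by simp
  simp only [dd, this, map_add, map_smul]

/-- The tensor `h - e H g` with a constant `e`. -/
def pinchForm (F N : ℝ × Model n → E) (H : ℝ × Model n → ℝ) (e : ℝ) (a b : Model n)
    (z : ℝ × Model n) : ℝ :=
  sff F N a b z - e * (H z * ⟪dd (0, a) F z, dd (0, b) F z⟫)

variable (D : GraphFlow F N H W Ω t₀)
include D

theorem sff_add_smul (a b : Model n) (s : ℝ) : ∀ z ∈ Ω,
    sff F N (a + s • b) (a + s • b) z =
      sff F N a a z + 2 * s * sff F N a b z + s ^ 2 * sff F N b b z := fun z hz => by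
  have h1 : dd (0, a + s • b) (dd (0, a + s • b) F) z =
      dd (0, a + s • b) (fun z => dd (0, a) F z + s • dd (0, b) F z) z :=
    dd_congr D.isOpen (fun z _ => dd_add_smul F a b s z) _ z hz
  have h2 : ∀ c, dd c (fun z => dd (0, a) F z + s • dd (0, b) F z) z =
      dd c (dd (0, a) F) z + s • dd c (dd (0, b) F) z := fun c => by
    rw [dd_add (g := fun z => s • dd (0, b) F z) D.isOpen (D.smoothF1 _)
      (contDiffOn_const.smul (D.smoothF1 _)) c z hz,
      dd_smul (f := fun _ => s) D.isOpen contDiffOn_const (D.smoothF1 _) c z hz, dd_const]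
    simp
  have h3 := D.sff_comm a b z hz
  simp only [sff] at h3 ⊢
  rw [h1, dd_add_smul, h2, h2]
  simp only [inner_add_right, real_inner_smul_right]
  linear_combination (-s) * h3

theorem pinchForm_add_smul (e : ℝ) (a b : Model n) (s : ℝ) : ∀ z ∈ Ω,
    pinchForm F N H e (a + s • b) (a + s • b) z = pinchForm F N H e a a z +
      2 * s * pinchForm F N H e a b z + s ^ 2 * pinchForm F N H e b b z := fun z hz => by
  simp only [pinchForm, D.sff_add_smul a b s z hz, dd_add_smul, inner_add_left, inner_add_right,
    real_inner_smul_left, real_inner_smul_right]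
  rw [real_inner_comm (dd (0, a) F z) (dd (0, b) F z)]
  ring

theorem smooth_metric (a b : Model n) :
    ContDiffOn ℝ ∞ (fun z => ⟪dd (0, a) F z, dd (0, b) F z⟫) Ω :=
  (D.smoothF1 _).inner ℝ (D.smoothF1 _)

theorem smooth_pinchForm (e : ℝ) (a b : Model n) :
    ContDiffOn ℝ ∞ (pinchForm F N H e a b) Ω :=
  (D.smooth_sff a b).sub (contDiffOn_const.mul (D.smoothH.mul (D.smooth_metric a b)))

theorem dd_pinchForm (e : ℝ) (a b : Model n) (c : ℝ × Model n) : ∀ z ∈ Ω,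
    dd c (pinchForm F N H e a b) z = dd c (sff F N a b) z -
      e * dd c (fun z => H z * ⟪dd (0, a) F z, dd (0, b) F z⟫) z := fun z hz => by
  have h := dd_sub (g := fun z => e * (H z * ⟪dd (0, a) F z, dd (0, b) F z⟫)) D.isOpen
    (D.smooth_sff a b) (contDiffOn_const.mul (D.smoothH.mul (D.smooth_metric a b))) c z hz
  rw [dd_mul (f := fun _ => e) D.isOpen contDiffOn_const (D.smoothH.mul (D.smooth_metric a b))
    c z hz, dd_const, zero_mul, zero_add] at h
  exact h

theorem dd_pinchForm_base (e : ℝ) (a b c : Model n) :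
    dd (0, c) (pinchForm F N H e a b) (t₀, 0) =
      dd (0, c) (sff F N a b) (t₀, 0) - e * (dd (0, c) H (t₀, 0) * ⟪a, b⟫) := by
  rw [D.dd_pinchForm e a b _ _ D.mem, dd_mul D.isOpen D.smoothH (D.smooth_metric a b) _ _ D.mem,
    D.dd_metric_base, D.isometric]
  ring

theorem dd_dd_pinchForm_base (e : ℝ) (a c : Model n) :
    dd (0, c) (dd (0, c) (pinchForm F N H e a a)) (t₀, 0) =
      dd (0, c) (dd (0, c) (sff F N a a)) (t₀, 0) -
        e * (dd (0, c) (dd (0, c) H) (t₀, 0) * ⟪a, a⟫ +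
          2 * H (t₀, 0) * sff F N a c (t₀, 0) ^ 2) := by
  have hs := D.smoothH.mul (D.smooth_metric a a)
  have hs1 := smooth_dd D.isOpen hs (0, c)
  rw [dd_congr D.isOpen (D.dd_pinchForm e a a (0, c)) _ _ D.mem,
    dd_sub (g := fun z => e * dd (0, c) (fun z => H z * ⟪dd (0, a) F z, dd (0, a) F z⟫) z)
      D.isOpen (smooth_dd D.isOpen (D.smooth_sff a a) _) (contDiffOn_const.mul hs1) _ _ D.mem,
    dd_mul (f := fun _ => e) D.isOpen contDiffOn_const hs1 _ _ D.mem, dd_const,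
    dd_dd_mul D.isOpen D.smoothH (D.smooth_metric a a) _ _ D.mem, D.dd_metric_base,
    D.dd_dd_metric_base, D.isometric]
  ring

/-- The second order condition at a null vector `w` of a nonnegative pinching form, tested on the
vector field `w + γ y`. -/
theorem second_order_test {e : ℝ}
    (hS : ∀ y, (t₀, y) ∈ Ω → ∀ a, 0 ≤ pinchForm F N H e a a (t₀, y))
    {w : Model n} (hw : pinchForm F N H e w w (t₀, 0) = 0) (c : Model n) (γ : ℝ) :
    0 ≤ dd (0, c) (dd (0, c) (pinchForm F N H e w w)) (t₀, 0) +
      4 * γ * dd (0, c) (pinchForm F N H e w c) (t₀, 0) +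
      2 * γ ^ 2 * pinchForm F N H e c c (t₀, 0) := by
  have hO : ∀ᶠ s : ℝ in 𝓝 0, ((t₀, 0) : ℝ × Model n) + s • (0, c) ∈ Ω := by
    have : Filter.Tendsto (fun s : ℝ => ((t₀, 0) : ℝ × Model n) + s • (0, c)) (𝓝 0)
        (𝓝 ((t₀, 0) + (0 : ℝ) • (0, c))) :=
      Continuous.tendsto (by fun_prop) 0
    rw [zero_smul, add_zero] at this
    exact this (D.isOpen.mem_nhds D.mem)
  set P : Model n → Model n → ℝ → ℝ :=
    fun a b s => pinchForm F N H e a b ((t₀, 0) + s • (0, c)) with hP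
  set P' : Model n → Model n → ℝ → ℝ :=
    fun a b s => dd (0, c) (pinchForm F N H e a b) ((t₀, 0) + s • (0, c)) with hP'
  have hd : ∀ a b, ∀ s : ℝ, ((t₀, 0) : ℝ × Model n) + s • (0, c) ∈ Ω →
      HasDerivAt (P a b) (P' a b s) s := fun a b s hs =>
    hasDerivAt_line D.isOpen (D.smooth_pinchForm e a b) _ _ s hs
  have hd' : ∀ a b, ∀ s : ℝ, ((t₀, 0) : ℝ × Model n) + s • (0, c) ∈ Ω →
      HasDerivAt (P' a b) (dd (0, c) (dd (0, c) (pinchForm F N H e a b)) ((t₀, 0) + s • (0, c))) s :=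
    fun a b s hs =>
      hasDerivAt_line D.isOpen (smooth_dd D.isOpen (D.smooth_pinchForm e a b) _) _ _ s hs
  have hz : ((t₀, 0) : ℝ × Model n) + (0 : ℝ) • (0, c) ∈ Ω := by simpa using D.mem
  -- The function below is the pinching form on w + γ s c at the point s c, expanded in γ s. Its
  -- second derivative at 0 produces the coefficients 4γ and 2γ².
  have h1 : ∀ᶠ s in 𝓝 (0 : ℝ), HasDerivAt
      (fun s => P w w s + 2 * γ * (s * P w c s) + γ ^ 2 * (s ^ 2 * P c c s))
      (P' w w s + 2 * γ * (P w c s + s * P' w c s) +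
        γ ^ 2 * (2 * s * P c c s + s ^ 2 * P' c c s)) s := by
    filter_upwards [hO] with s hs
    have h2 := (hd w w s hs).add (((hasDerivAt_id s).mul (hd w c s hs)).const_mul (2 * γ))
    have h3 := h2.add ((((hasDerivAt_id s).pow 2).mul (hd c c s hs)).const_mul (γ ^ 2))
    refine h3.congr_deriv ?_
    simp
  have h2 : HasDerivAt (fun s => P' w w s + 2 * γ * (P w c s + s * P' w c s) +
      γ ^ 2 * (2 * s * P c c s + s ^ 2 * P' c c s))
      (dd (0, c) (dd (0, c) (pinchForm F N H e w w)) ((t₀, 0) + (0 : ℝ) • (0, c)) +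
        2 * γ * (P' w c 0 + P' w c 0) + γ ^ 2 * (2 * P c c 0)) 0 := by
    have i1 := (hd' w w 0 hz).add (((hd w c 0 hz).add
      ((hasDerivAt_id 0).mul (hd' w c 0 hz))).const_mul (2 * γ))
    have i2 := i1.add (((((hasDerivAt_id (0 : ℝ)).const_mul 2).mul (hd c c 0 hz)).add
      (((hasDerivAt_id (0 : ℝ)).pow 2).mul (hd' c c 0 hz))).const_mul (γ ^ 2))
    refine i2.congr_deriv ?_
    simp
  have h3 : IsLocalMin (fun s => P w w s + 2 * γ * (s * P w c s) + γ ^ 2 * (s ^ 2 * P c c s))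
      0 := by
    filter_upwards [hO] with s hs
    have e0 : P w w 0 = 0 := by simp [hP, hw]
    have e1 := D.pinchForm_add_smul e w c (γ * s) _ hs
    have hs' : ((t₀, 0) : ℝ × Model n) + s • (0, c) = (t₀, s • c) := by simp
    have e2 := hS (s • c) (hs' ▸ hs) (w + (γ * s) • c)
    rw [← hs', e1] at e2
    simp only [hP] at e0 e2 ⊢
    linarith
  have h4 := (second_deriv_nonneg_of_isLocalMin h1 h2 h3).2
  simp only [hP, hP', zero_smul, add_zero] at h4
  linarith

end GraphFlow

end IMCF
end

/-! ### The maximum principle at a point -/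

noncomputable section

namespace IMCF

/-- A nonnegative quadratic form with trace `τ` has Hilbert-Schmidt norm at most `τ`. -/
theorem sum_sq_le_sq_trace {n : ℕ} {s : Fin n → Fin n → ℝ}
    (hs : ∀ i j (r : ℝ), 0 ≤ s i i + 2 * r * s i j + r ^ 2 * s j j) :
    ∑ i, ∑ j, s i j ^ 2 ≤ (∑ i, s i i) ^ 2 := by
  rw [sq (∑ i, s i i), Finset.sum_mul_sum]
  refine Finset.sum_le_sum fun i _ => Finset.sum_le_sum fun j _ => ?_
  -- Nonnegativity in `r` gives s_ij² ≤ s_ii s_jj through the discriminant.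
  have hd := discrim_le_zero (a := s j j) (b := 2 * s i j) (c := s i i) fun r => by
    have := hs i j r; nlinarith
  rw [discrim] at hd
  nlinarith

theorem sq_trace_le {n : ℕ} (s : Fin n → Fin n → ℝ) :
    (∑ i, s i i) ^ 2 ≤ n * ∑ i, ∑ j, s i j ^ 2 := by
  have h1 : (∑ i, s i i) ^ 2 ≤ n * ∑ i, s i i ^ 2 := by
    simpa using sq_sum_le_card_mul_sum_sq (s := Finset.univ) (f := fun i => s i i)
  refine h1.trans (mul_le_mul_of_nonneg_left (Finset.sum_le_sum fun i _ => ?_) (by positivity))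
  exact Finset.single_le_sum (f := fun j => s i j ^ 2) (fun j _ => sq_nonneg _) (Finset.mem_univ i)

theorem sum_sq_coord {n : ℕ} {w : Model n} (hw1 : ⟪w, w⟫ = 1) : ∑ i, w i ^ 2 = 1 := by
  rw [← hw1, PiLp.inner_apply]
  simp [sq]

namespace GraphFlow

variable {n : ℕ} {E : Type*} [NormedAddCommGroup E] [InnerProductSpace ℝ E]
  {F N : ℝ × Model n → E} {H : ℝ × Model n → ℝ}
  {W : Fin n → Fin n → ℝ × Model n → ℝ}
  {Ω : Set (ℝ × Model n)} {t₀ : ℝ}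
  (D : GraphFlow F N H W Ω t₀)
include D

theorem pinchForm_base (e : ℝ) (a b : Model n) : pinchForm F N H e a b (t₀, 0) =
    sff F N a b (t₀, 0) - e * (H (t₀, 0) * ⟪a, b⟫) := by
  rw [pinchForm, D.isometric]

/-- A nonnegative quadratic form that vanishes on `w` has `w` in its kernel: otherwise the linear
term of S(w + s c, w + s c) would change sign. -/
theorem null_vector {e : ℝ} (hS : ∀ a, 0 ≤ pinchForm F N H e a a (t₀, 0))
    {w : Model n} (hw : pinchForm F N H e w w (t₀, 0) = 0) (c : Model n) :
    sff F N w c (t₀, 0) = e * (H (t₀, 0) * ⟪w, c⟫) := by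
  have h : 2 * pinchForm F N H e w c (t₀, 0) = 0 :=
    eq_zero_of_forall_quadratic_nonneg (q := pinchForm F N H e c c (t₀, 0)) fun s => by
      have h1 := hS (w + s • c)
      rw [D.pinchForm_add_smul e w c s _ D.mem, hw] at h1
      linarith
  rw [D.pinchForm_base] at h
  linarith

/-- By `null_vector`, `w` is a principal direction with principal curvature e H. -/
theorem dd_normal_null {e : ℝ} (hS : ∀ a, 0 ≤ pinchForm F N H e a a (t₀, 0))
    {w : Model n} (hw : pinchForm F N H e w w (t₀, 0) = 0) :
    dd (0, w) N (t₀, 0) = (e * H (t₀, 0)) • dd (0, w) F (t₀, 0) := by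
  rw [← sub_eq_zero]
  apply D.span
  · rw [inner_sub_left, real_inner_smul_left, D.inner_dd_normal _ _ D.mem,
      D.inner_tangent_normal]
    ring
  · intro a
    rw [inner_sub_left, real_inner_smul_left, D.sff_eq _ _ _ D.mem, D.isometric,
      D.sff_comm _ _ _ D.mem, D.null_vector hS hw]
    ring

/-- The spatial part of the maximum principle, including the gradient terms. -/
theorem spatial_inequality {e : ℝ}
    (hS : ∀ y, (t₀, y) ∈ Ω → ∀ a, 0 ≤ pinchForm F N H e a a (t₀, y))
    {w : Model n} (hw1 : ⟪w, w⟫ = 1) (hw : pinchForm F N H e w w (t₀, 0) = 0) (γ : ℝ) :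
    0 ≤ dd (0, w) (dd (0, w) H) (t₀, 0) - e * ∑ i, dd (0, bv i) (dd (0, bv i) H) (t₀, 0) +
      e ^ 2 * H (t₀, 0) ^ 3 -
      e * H (t₀, 0) * ∑ i, ∑ j, sff F N (bv i) (bv j) (t₀, 0) ^ 2 +
      4 * γ * ((1 - e) * dd (0, w) H (t₀, 0)) +
      2 * γ ^ 2 * ((1 - n * e) * H (t₀, 0)) := by
  have hS0 := hS 0 D.mem
  have hnull := D.null_vector hS0 hw
  have hwc := sum_sq_coord hw1
  have hww : sff F N w w (t₀, 0) = e * H (t₀, 0) := by rw [hnull, hw1, mul_one]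
  have hNN : ⟪dd (0, w) N (t₀, 0), dd (0, w) N (t₀, 0)⟫ = e ^ 2 * H (t₀, 0) ^ 2 := by
    rw [D.dd_normal_null hS0 hw, real_inner_smul_left, real_inner_smul_right, D.isometric, hw1]
    ring
  have hNi : ∀ i, ⟪dd (0, bv i) N (t₀, 0), dd (0, w) N (t₀, 0)⟫ = e ^ 2 * H (t₀, 0) ^ 2 * w i :=
    fun i => by
    rw [D.dd_normal_null hS0 hw, real_inner_smul_right, D.sff_eq _ _ _ D.mem, hnull,
      inner_bv_right]
    ring
  have hiw : ∀ i, sff F N (bv i) w (t₀, 0) = e * H (t₀, 0) * w i := fun i => by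
    rw [D.sff_comm _ _ _ D.mem, hnull, inner_bv_right]; ring
  -- These fourth derivatives occur both in the Hessian of H in direction `w` and in the Laplacian
  -- of h(w, w). Eliminating them is Simons' identity.
  set q : Fin n → ℝ := fun i =>
    ⟪N (t₀, 0), dd (0, bv i) (dd (0, bv i) (dd (0, w) (dd (0, w) F))) (t₀, 0)⟫ with hq
  -- the Hessian of the mean curvature in the null direction
  have hHww : dd (0, w) (dd (0, w) H) (t₀, 0) =
      - ∑ i, q i - e ^ 2 * H (t₀, 0) ^ 3 - 2 * e ^ 3 * H (t₀, 0) ^ 3 := by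
    rw [D.dd_dd_meanCurv_base]
    have : ∀ i, dd (0, w) (dd (0, w) (sff F N (bv i) (bv i))) (t₀, 0) -
        2 * (sff F N (bv i) w (t₀, 0) * ⟪dd (0, bv i) N (t₀, 0), dd (0, w) N (t₀, 0)⟫) =
        - q i - e ^ 2 * H (t₀, 0) ^ 2 * sff F N (bv i) (bv i) (t₀, 0) -
          2 * e ^ 3 * H (t₀, 0) ^ 3 * w i ^ 2 := fun i => by
      rw [D.dd_dd_sff_base, hNN, hNi, hiw, D.fourth_derivative_comm (bv i) w]
      ring
    simp only [this, Finset.sum_sub_distrib, ← Finset.mul_sum, hwc, ← D.meanCurv_base,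
      Finset.sum_neg_distrib]
    ring
  -- The test is summed over an orthonormal basis. In the terms linear in γ, Codazzi turns ∂ᵢ h(w,
  -- bᵢ) into ∂_w h(bᵢ, bᵢ), whose sum is ∂_w H.
  have key := Finset.sum_nonneg (s := Finset.univ) fun (i : Fin n) _ => D.second_order_test hS hw (bv i) γ
  have hterm : ∀ i : Fin n, dd (0, bv i) (dd (0, bv i) (pinchForm F N H e w w)) (t₀, 0) +
      4 * γ * dd (0, bv i) (pinchForm F N H e w (bv i)) (t₀, 0) +
      2 * γ ^ 2 * pinchForm F N H e (bv i) (bv i) (t₀, 0) =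
      - q i - e * H (t₀, 0) * ∑ j, sff F N (bv i) (bv j) (t₀, 0) ^ 2 -
      e * dd (0, bv i) (dd (0, bv i) H) (t₀, 0) - 2 * e ^ 3 * H (t₀, 0) ^ 3 * w i ^ 2 +
      4 * γ * dd (0, w) (sff F N (bv i) (bv i)) (t₀, 0) -
      4 * γ * e * (w i * dd (0, bv i) H (t₀, 0)) +
      2 * γ ^ 2 * sff F N (bv i) (bv i) (t₀, 0) - 2 * γ ^ 2 * e * H (t₀, 0) := fun i => by
    have hA : ⟪dd (0, bv i) N (t₀, 0), dd (0, bv i) N (t₀, 0)⟫ =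
        ∑ j, sff F N (bv i) (bv j) (t₀, 0) ^ 2 := by
      rw [D.inner_dd_normal_base]; simp only [sq]
    rw [D.dd_dd_pinchForm_base, D.dd_pinchForm_base, D.pinchForm_base, D.dd_dd_sff_base, hA, hww,
      D.sff_comm w (bv i) _ D.mem, hiw, hw1, inner_bv_right, inner_bv, if_pos rfl,
      D.dd_sff_swap w, D.codazzi]
    ring
  simp only [hterm, Finset.sum_sub_distrib, Finset.sum_add_distrib, ← Finset.mul_sum, hwc,
    ← D.meanCurv_base, ← D.dd_meanCurv_base, Finset.sum_neg_distrib, Finset.sum_const,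
    Finset.card_univ, Fintype.card_fin, nsmul_eq_mul] at key
  have hgrad := dd_eq_sum H w (t₀, 0)
  simp only [smul_eq_mul] at hgrad
  rw [← hgrad] at key
  rw [hHww]
  linarith

/-- The temporal part of the maximum principle. -/
theorem time_inequality {ε : ℝ → ℝ} {ε' : ℝ} (hε : HasDerivAt ε ε' t₀)
    (hS : ∀ z ∈ Ω, z.1 ≤ t₀ → ∀ a, 0 ≤ pinchForm F N H (ε z.1) a a z)
    {w : Model n} (hw1 : ⟪w, w⟫ = 1) (hw : pinchForm F N H (ε t₀) w w (t₀, 0) = 0) :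
    - dd (0, w) (dd (0, w) (fun z => (H z)⁻¹)) (t₀, 0) +
      ε t₀ * ∑ i, dd (0, bv i) (dd (0, bv i) (fun z => (H z)⁻¹)) (t₀, 0) -
      ε t₀ ^ 2 * H (t₀, 0) +
      ε t₀ * (H (t₀, 0))⁻¹ * ∑ i, ∑ j, sff F N (bv i) (bv j) (t₀, 0) ^ 2 ≤ ε' * H (t₀, 0) := by
  have hS0 := hS _ D.mem le_rfl
  have hnull := D.null_vector hS0 hw
  have hH := (D.pos _ D.mem).ne'
  have hww : sff F N w w (t₀, 0) = ε t₀ * H (t₀, 0) := by rw [hnull, hw1, mul_one]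
  have hz : ((t₀, 0) : ℝ × Model n) + (0 : ℝ) • (1, 0) ∈ Ω := by simpa using D.mem
  have hm := D.smoothH.mul (D.smooth_metric w w)
  have h1 := hasDerivAt_line D.isOpen (D.smooth_sff w w) (t₀, 0) (1, 0) 0 hz
  have h2 := hasDerivAt_line D.isOpen hm (t₀, 0) (1, 0) 0 hz
  have h3 : HasDerivAt (fun s => ε (t₀ + s)) ε' 0 := by
    have : HasDerivAt ε ε' (t₀ + 0) := by simpa using hε
    exact this.comp_const_add t₀ 0
  have h4 := h1.sub (h3.mul h2)
  -- With `w` held constant in the coordinates, the form is zero at t₀ and nonnegative just before,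
  -- so its time derivative is at most zero.
  have h5 := deriv_nonpos_of_nonneg_left h4 (by
    have : Filter.Tendsto (fun s : ℝ => ((t₀, 0) : ℝ × Model n) + s • (1, 0)) (𝓝 0)
        (𝓝 ((t₀, 0) + (0 : ℝ) • (1, 0))) :=
      Continuous.tendsto (by fun_prop) 0
    have h6 := this (D.isOpen.mem_nhds hz)
    filter_upwards [nhdsWithin_le_nhds h6, self_mem_nhdsWithin] with s hs hlt
    have h7 := hS _ hs (by simpa using (Set.mem_Iio.1 hlt).le) w
    simp only [pinchForm, Prod.fst_add, Prod.smul_fst, smul_eq_mul, mul_one] at h7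
    simp only [pinchForm] at hw
    simp only [Pi.sub_apply, Pi.mul_apply, zero_smul, add_zero]
    rw [hw]
    exact h7)
  simp only [zero_smul, add_zero] at h5
  rw [dd_mul D.isOpen D.smoothH (D.smooth_metric w w) _ _ D.mem,
    dd_inner D.isOpen (D.smoothF1 _) (D.smoothF1 _) _ _ D.mem,
    real_inner_comm (dd (1, 0) (dd (0, w) F) (t₀, 0)) (dd (0, w) F (t₀, 0)),
    D.inner_dd_time_tangent_base, D.isometric, hw1, D.dd_time_sff_base,
    D.dd_time_meanCurv_base, hww, D.dd_normal_null hS0 hw, real_inner_smul_left,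
    real_inner_smul_right, D.isometric, hw1] at h5
  have h8 : (H (t₀, 0))⁻¹ * (ε t₀ * H (t₀, 0)) = ε t₀ := by field_simp
  have h9 : (H (t₀, 0))⁻¹ * (ε t₀ * H (t₀, 0) * (ε t₀ * H (t₀, 0) * 1)) =
      ε t₀ ^ 2 * H (t₀, 0) := by field_simp
  rw [h8, h9] at h5
  linarith

/-- If the pinching inequality with factor `ε t` becomes an equality at time `t₀` for the first
time, then the derivative of `ε` is bounded from below. Here `A = |h|² / H²`, and `b` controls the
gradient terms. -/
theorem pinching_speed (hn : 1 ≤ n) {ε : ℝ → ℝ} {ε' : ℝ} (hε : HasDerivAt ε ε' t₀)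
    (hS : ∀ z ∈ Ω, z.1 ≤ t₀ → ∀ a, 0 ≤ pinchForm F N H (ε z.1) a a z)
    {w : Model n} (hw1 : ⟪w, w⟫ = 1) (hw : pinchForm F N H (ε t₀) w w (t₀, 0) = 0) :
    ∃ A b : ℝ, 1 / n ≤ A ∧ (|ε t₀| ≤ 1 → A ≤ (n + 2) ^ 2) ∧ 0 ≤ b ∧
      b ≤ 2 * n * ‖dd (1, 0) N (t₀, 0)‖ ^ 2 ∧ 2 * ε t₀ * (A - ε t₀) + ε t₀ * b ≤ ε' := by
  have hT := D.time_inequality hε hS hw1 hw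
  -- With γ = -∂_w H / H the gradient terms here become (-2 + 4e - 2ne)(∂_w H)²/H. The -2 cancels
  -- the term from the Hessian of 1/H, and every remaining gradient term has a factor e.
  have hX := D.spatial_inequality (e := ε t₀) (fun y hy a => hS _ hy le_rfl a) hw1 hw
    (- (dd (0, w) H (t₀, 0) / H (t₀, 0)))
  have hS0 := hS _ D.mem le_rfl
  have hH := D.pos _ D.mem
  have hn' : (1 : ℝ) ≤ n := by exact_mod_cast hn
  set e := ε t₀ with he
  set H0 := H (t₀, 0) with hH0
  set Hw := dd (0, w) H (t₀, 0) with hHw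
  set A2 := ∑ i, ∑ j, sff F N (bv i) (bv j) (t₀, 0) ^ 2 with hA2
  set Q := ∑ i, dd (0, bv i) H (t₀, 0) ^ 2 with hQ
  have hQ0 : 0 ≤ Q := Finset.sum_nonneg fun i _ => sq_nonneg _
  have hQw : Hw ^ 2 ≤ Q := by
    have h1 := dd_eq_sum H w (t₀, 0)
    simp only [smul_eq_mul] at h1
    rw [hHw, h1]
    have h2 := Finset.sum_mul_sq_le_sq_mul_sq Finset.univ (fun i => w i)
      (fun i => dd (0, bv i) H (t₀, 0))
    rwa [sum_sq_coord hw1, one_mul] at h2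
  -- The tangential part of ∂N/∂t is minus the gradient of 1/H, of squared length |∇H|²/H⁴; the
  -- bound is Bessel's inequality.
  have hQN : Q / H0 ^ 4 ≤ ‖dd (1, 0) N (t₀, 0)‖ ^ 2 := by
    have ho : Orthonormal ℝ (fun i : Fin n => dd (0, bv i) F (t₀, 0)) := by
      rw [orthonormal_iff_ite]
      intro i j
      rw [D.isometric, inner_bv]
    have h1 := ho.sum_inner_products_le (dd (1, 0) N (t₀, 0)) (s := Finset.univ)
    refine le_trans (le_of_eq ?_) h1
    rw [hQ, Finset.sum_div]
    refine Finset.sum_congr rfl fun i _ => ?_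
    rw [real_inner_comm, D.inner_dd_time_normal _ _ D.mem, D.dd_inv _ _ D.mem, Real.norm_eq_abs,
      sq_abs, ← hH0]
    field_simp
  have hfsum : ∑ i, dd (0, bv i) (dd (0, bv i) (fun z => (H z)⁻¹)) (t₀, 0) =
      - (∑ i, dd (0, bv i) (dd (0, bv i) H) (t₀, 0)) / H0 ^ 2 + 2 * Q / H0 ^ 3 := by
    simp only [D.dd_dd_inv _ _ D.mem, Finset.sum_add_distrib, ← Finset.sum_div, ← Finset.mul_sum,
      Finset.sum_neg_distrib, hQ, ← hH0]
  rw [hfsum, D.dd_dd_inv _ _ D.mem, ← hH0, ← hHw] at hT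
  set L := ∑ i, dd (0, bv i) (dd (0, bv i) H) (t₀, 0) with hL
  set Hww := dd (0, w) (dd (0, w) H) (t₀, 0) with hHww
  have hAlow : H0 ^ 2 ≤ n * A2 := by
    rw [hH0, D.meanCurv_base]; 
    exact sq_trace_le fun i j => sff F N (bv i) (bv j) (t₀, 0)
  refine ⟨A2 / H0 ^ 2, ((2 * n - 4) * Hw ^ 2 + 2 * Q) / H0 ^ 4, ?_, ?_, ?_, ?_, ?_⟩
  · rw [div_le_div_iff₀ (by positivity) (by positivity)]; linarith
  · intro he1
    obtain ⟨he2, he3⟩ := abs_le.1 he1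
    -- Comparing the norm of S with its trace gives A ≤ (1 - ne)² + 2e - ne², which is at most (n +
    -- 2)² when |e| ≤ 1.
    have h1 : ∑ i, ∑ j, pinchForm F N H e (bv i) (bv j) (t₀, 0) ^ 2 ≤
        (∑ i, pinchForm F N H e (bv i) (bv i) (t₀, 0)) ^ 2 := by
      refine sum_sq_le_sq_trace fun i j r => ?_
      rw [← D.pinchForm_add_smul e (bv i) (bv j) r _ D.mem]
      exact hS0 _
    have h2 : ∀ i j : Fin n, pinchForm F N H e (bv i) (bv j) (t₀, 0) =
        sff F N (bv i) (bv j) (t₀, 0) - if i = j then e * H0 else 0 := fun i j => by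
      rw [D.pinchForm_base, inner_bv]; split_ifs <;> simp [hH0]
    have h3 : ∑ i, pinchForm F N H e (bv i) (bv i) (t₀, 0) = (1 - n * e) * H0 := by
      simp only [h2, if_true, Finset.sum_sub_distrib, ← D.meanCurv_base]
      simp [← hH0]; ring
    have h4 : ∑ i, ∑ j, pinchForm F N H e (bv i) (bv j) (t₀, 0) ^ 2 =
        A2 - 2 * e * H0 ^ 2 + n * e ^ 2 * H0 ^ 2 := by
      have h5 : ∀ i j : Fin n, pinchForm F N H e (bv i) (bv j) (t₀, 0) ^ 2 =
          sff F N (bv i) (bv j) (t₀, 0) ^ 2 + if i = j then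
            (e ^ 2 * H0 ^ 2 - 2 * e * H0 * sff F N (bv i) (bv i) (t₀, 0)) else 0 := fun i j => by
        rw [h2]; split_ifs with h
        · subst h; ring
        · ring
      simp only [h5, Finset.sum_add_distrib, Finset.sum_ite_eq, Finset.mem_univ, if_true,
        Finset.sum_sub_distrib, ← Finset.mul_sum, ← D.meanCurv_base]
      simp [← hH0, ← hA2]; ring
    rw [h3, h4] at h1
    rw [div_le_iff₀ (by positivity)]
    have h6 : A2 ≤ ((1 - n * e) ^ 2 + 2 * e - n * e ^ 2) * H0 ^ 2 := by linarith
    refine h6.trans (mul_le_mul_of_nonneg_right ?_ (by positivity))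
    nlinarith [mul_nonneg (sub_nonneg.2 hn') (sub_nonneg.2 hn'),
      mul_nonneg (by linarith : 0 ≤ 1 - e) (by linarith : 0 ≤ 1 + e),
      mul_nonneg (by positivity : (0:ℝ) ≤ n * n)
        (mul_nonneg (by linarith : 0 ≤ 1 - e) (by linarith : 0 ≤ 1 + e)),
      mul_nonneg (by positivity : (0:ℝ) ≤ n) (by linarith : 0 ≤ 1 + e), sq_nonneg e,
      mul_nonneg (by positivity : (0:ℝ) ≤ n) (sq_nonneg e)]
  · refine div_nonneg ?_ (by positivity)
    nlinarith [mul_nonneg (sub_nonneg.2 hn') (sq_nonneg Hw)]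
  · have h1 : ((2 * n - 4) * Hw ^ 2 + 2 * Q) / H0 ^ 4 ≤ 2 * n * (Q / H0 ^ 4) := by
      rw [← mul_div_assoc]
      refine div_le_div_of_nonneg_right ?_ (by positivity)
      nlinarith [mul_nonneg (sub_nonneg.2 hn') (sub_nonneg.2 hQw), sq_nonneg Hw]
    exact h1.trans (mul_le_mul_of_nonneg_left hQN (by positivity))
  · have h1 : 0 ≤ (Hww - e * L + e ^ 2 * H0 ^ 3 - e * H0 * A2 +
        4 * -(Hw / H0) * ((1 - e) * Hw) +
        2 * (-(Hw / H0)) ^ 2 * ((1 - n * e) * H0)) / H0 ^ 2 := div_nonneg hX (by positivity)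
    have h2 : (2 * e * (A2 / H0 ^ 2 - e) +
        e * (((2 * n - 4) * Hw ^ 2 + 2 * Q) / H0 ^ 4)) * H0 ≤ ε' * H0 := by
      refine le_trans (le_of_sub_nonneg ?_) hT
      refine h1.trans (le_of_eq ?_)
      field_simp
      ring
    exact le_of_mul_le_mul_right h2 hH

end GraphFlow

end IMCF
end

/-! ### Local parametrisations of the sphere -/

noncomputable section

namespace IMCF

/-! ### The time interval -/

section TimeInterval

variable {T : EReal}

theorem convex_timeInterval : Convex ℝ (timeInterval T) := by
  rw [convex_iff_ordConnected]
  refine ⟨fun a ha b hb c hc => ⟨ha.1.trans hc.1, lt_of_le_of_lt ?_ hb.2⟩⟩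
  exact_mod_cast hc.2

theorem isOpen_openTimeInterval : IsOpen {t : ℝ | 0 < t ∧ (t : EReal) < T} :=
  (isOpen_lt continuous_const continuous_id).inter
    (isOpen_lt continuous_coe_real_ereal continuous_const)

theorem openTimeInterval_subset : {t : ℝ | 0 < t ∧ (t : EReal) < T} ⊆ timeInterval T :=
  fun _ ht => ⟨ht.1.le, ht.2⟩

theorem timeInterval_mem_nhds {t : ℝ} (ht : t ∈ timeInterval T) (h0 : 0 < t) :
    timeInterval T ∈ 𝓝 t :=
  Filter.mem_of_superset (isOpen_openTimeInterval.mem_nhds (show t ∈ {t : ℝ | 0 < t ∧ (t : EReal) < T} from ⟨h0, ht.2⟩))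
    openTimeInterval_subset

theorem uniqueDiffOn_timeInterval (hT : 0 < T) : UniqueDiffOn ℝ (timeInterval T) := by
  refine uniqueDiffOn_convex convex_timeInterval ?_
  obtain ⟨t, ht0, htT⟩ := EReal.lt_iff_exists_real_btwn.1 hT
  have ht0' : (0 : ℝ) < t := by exact_mod_cast ht0
  exact ⟨t, interior_maximal openTimeInterval_subset isOpen_openTimeInterval ⟨ht0', htT⟩⟩

end TimeInterval

/-- The part of the hypotheses on a family of hypersurfaces that is local. -/
structure ImmersedFamily {n : ℕ} (T : EReal) (X ν : ℝ → Sph n → Ambient n) : Prop where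
  smooth : ContMDiffOn (𝓘(ℝ, ℝ).prod (𝓡 n)) 𝓘(ℝ, Ambient n) ∞
    (fun p : ℝ × Sph n => X p.1 p.2) (timeInterval T ×ˢ Set.univ)
  smooth_normal : ContMDiffOn (𝓘(ℝ, ℝ).prod (𝓡 n)) 𝓘(ℝ, Ambient n) ∞
    (fun p : ℝ × Sph n => ν p.1 p.2) (timeInterval T ×ˢ Set.univ)
  immersion : ∀ t ∈ timeInterval T, ∀ x, Function.Injective (diff (X t) x)
  norm_normal : ∀ t ∈ timeInterval T, ∀ x, ‖ν t x‖ = 1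
  normal : ∀ t ∈ timeInterval T, ∀ x, ∀ v : Tan x, ⟪ν t x, diff (X t) x v⟫ = 0

/-- The differential of a local parametrisation, in the preferred chart. -/
def paramDiff {n : ℕ} (σ : Model n → Sph n) (y : Model n) : Model n →L[ℝ] Model n :=
  mfderiv 𝓘(ℝ, Model n) (𝓡 n) σ y

/-- The differential of a map on the sphere, in the preferred chart. -/
def modelDiff {n : ℕ} (F : Sph n → Ambient n) (x : Sph n) : Model n →L[ℝ] Ambient n :=
  diff F x

/-- A smooth local parametrisation of the sphere with invertible differential. -/
structure LocalParam {n : ℕ} (σ : Model n → Sph n) (U : Set (Model n)) : Prop where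
  isOpen : IsOpen U
  smooth : ContMDiffOn 𝓘(ℝ, Model n) (𝓡 n) ∞ σ U
  inj : ∀ y ∈ U, Function.Injective (paramDiff σ y)

theorem localParam_extChartAt {n : ℕ} (x : Sph n) :
    LocalParam (extChartAt (𝓡 n) x).symm (extChartAt (𝓡 n) x).target where
  isOpen := isOpen_extChartAt_target x
  smooth := contMDiffOn_extChartAt_symm x
  inj := fun y hy => by
    have h := isInvertible_mfderivWithin_extChartAt_symm hy
    rw [ModelWithCorners.range_eq_univ, mfderivWithin_univ] at h
    exact h.injective

/-! ### Restriction to time slices and to charts -/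

section Slices

variable {n : ℕ} {T : EReal} {G : ℝ → Sph n → Ambient n} {σ : Model n → Sph n}
  {U : Set (Model n)}

theorem contMDiff_slice
    (hG : ContMDiffOn (𝓘(ℝ, ℝ).prod (𝓡 n)) 𝓘(ℝ, Ambient n) ∞
      (fun p : ℝ × Sph n => G p.1 p.2) (timeInterval T ×ˢ Set.univ)) {t : ℝ}
    (ht : t ∈ timeInterval T) : ContMDiff (𝓡 n) 𝓘(ℝ, Ambient n) ∞ (G t) := by
  rw [← contMDiffOn_univ]
  have h : ContMDiffOn (𝓡 n) (𝓘(ℝ, ℝ).prod (𝓡 n)) ∞ (fun x : Sph n => (t, x)) Set.univ :=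
    (contMDiff_const.prodMk contMDiff_id).contMDiffOn
  exact hG.comp h fun x _ => ⟨ht, trivial⟩

theorem hasFDerivAt_param {t : ℝ} (hG : ContMDiff (𝓡 n) 𝓘(ℝ, Ambient n) ∞ (G t))
    (hσ : LocalParam σ U) {y : Model n} (hy : y ∈ U) :
    HasFDerivAt (fun y => G t (σ y)) ((modelDiff (G t) (σ y)).comp
      (paramDiff σ y)) y := by
  have h1 : HasMFDerivAt (𝓡 n) 𝓘(ℝ, Ambient n) (G t) (σ y)
      (mfderiv (𝓡 n) 𝓘(ℝ, Ambient n) (G t) (σ y)) :=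
    (hG.mdifferentiable (by simp) _).hasMFDerivAt
  have h2 : HasMFDerivAt 𝓘(ℝ, Model n) (𝓡 n) σ y (mfderiv 𝓘(ℝ, Model n) (𝓡 n) σ y) :=
    ((hσ.smooth.contMDiffAt (hσ.isOpen.mem_nhds hy)).mdifferentiableAt (by simp)).hasMFDerivAt
  exact (h1.comp y h2).hasFDerivAt

theorem contDiffOn_param
    (hG : ContMDiffOn (𝓘(ℝ, ℝ).prod (𝓡 n)) 𝓘(ℝ, Ambient n) ∞
      (fun p : ℝ × Sph n => G p.1 p.2) (timeInterval T ×ˢ Set.univ)) (hσ : LocalParam σ U) :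
    ContDiffOn ℝ ∞ (fun z : ℝ × Model n => G z.1 (σ z.2)) (timeInterval T ×ˢ U) := by
  rw [← contMDiffOn_iff_contDiffOn]
  have h1 : ContMDiffOn 𝓘(ℝ, ℝ × Model n) 𝓘(ℝ, ℝ) ∞ (Prod.fst : ℝ × Model n → ℝ)
      (timeInterval T ×ˢ U) := contDiff_fst.contMDiff.contMDiffOn
  have h2 : ContMDiffOn 𝓘(ℝ, ℝ × Model n) 𝓘(ℝ, Model n) ∞ (Prod.snd : ℝ × Model n → Model n)
      (timeInterval T ×ˢ U) := contDiff_snd.contMDiff.contMDiffOn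
  have h3 : ContMDiffOn 𝓘(ℝ, ℝ × Model n) (𝓘(ℝ, ℝ).prod (𝓡 n)) ∞
      (fun z : ℝ × Model n => (z.1, σ z.2)) (timeInterval T ×ˢ U) :=
    h1.prodMk (hσ.smooth.comp h2 fun z hz => hz.2)
  exact hG.comp h3 fun z hz => ⟨hz.1, trivial⟩

end Slices

/-- Smooth functions on a product have smooth partial derivatives, up to the boundary. -/
theorem contDiffOn_partial {V G : Type*} [NormedAddCommGroup V] [NormedSpace ℝ V]
    [NormedAddCommGroup G] [NormedSpace ℝ G] {I : Set ℝ} (hI : UniqueDiffOn ℝ I) {U : Set V}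
    (hU : IsOpen U) {F : ℝ × V → G} (hF : ContDiffOn ℝ ∞ F (I ×ˢ U)) (a : V) :
    ContDiffOn ℝ ∞ (fun z => fderiv ℝ (fun y => F (z.1, y)) z.2 a) (I ×ˢ U) := by
  have hu := hI.prod hU.uniqueDiffOn
  have h1 : ContDiffOn ℝ ∞ (fun z => fderivWithin ℝ F (I ×ˢ U) z (0, a)) (I ×ˢ U) :=
    (hF.fderivWithin hu (by simp)).clm_apply contDiffOn_const
  refine h1.congr fun z hz => ?_
  have h2 := ((hF.differentiableOn (by simp)) z hz).hasFDerivWithinAt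
  have h3 : HasFDerivWithinAt (fun y : V => (z.1, y)) (ContinuousLinearMap.inr ℝ ℝ V) U z.2 :=
    (hasFDerivAt_prodMk_right z.1 z.2).hasFDerivWithinAt
  have h4 := HasFDerivWithinAt.comp (g := F) z.2 h2 h3
    (show Set.MapsTo (fun y : V => (z.1, y)) U (I ×ˢ U) from fun y hy => ⟨hz.1, hy⟩)
  have h5 := h4.hasFDerivAt (hU.mem_nhds hz.2)
  have h6 : fderiv ℝ (fun y => F (z.1, y)) z.2 = _ := h5.fderiv
  rw [h6]; simp

theorem fderiv_slice_eq_dd {V G : Type*} [NormedAddCommGroup V] [NormedSpace ℝ V]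
    [NormedAddCommGroup G] [NormedSpace ℝ G] {F : ℝ × V → G} {z : ℝ × V}
    (hF : DifferentiableAt ℝ F z) (a : V) :
    fderiv ℝ (fun y => F (z.1, y)) z.2 a = dd (0, a) F z := by
  have h3 : HasFDerivAt (fun y : V => (z.1, y)) (ContinuousLinearMap.inr ℝ ℝ V) z.2 :=
    hasFDerivAt_prodMk_right z.1 z.2
  have h4 := HasFDerivAt.comp (g := F) z.2 hF.hasFDerivAt h3
  have h6 : fderiv ℝ (fun y => F (z.1, y)) z.2 = _ := h4.fderiv
  rw [h6]; simp [dd]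

theorem hasDerivAt_time_dd {V G : Type*} [NormedAddCommGroup V] [NormedSpace ℝ V]
    [NormedAddCommGroup G] [NormedSpace ℝ G] {F : ℝ × V → G} {z : ℝ × V}
    (hF : DifferentiableAt ℝ F z) :
    HasDerivAt (fun s => F (s, z.2)) (dd (1, 0) F z) z.1 := by
  have h3 : HasDerivAt (fun s : ℝ => (s, z.2)) ((1 : ℝ), (0 : V)) z.1 :=
    (hasDerivAt_id z.1).prodMk (hasDerivAt_const z.1 z.2)
  exact HasFDerivAt.comp_hasDerivAt (l := F) z.1 hF.hasFDerivAt h3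

/-! ### Independence of the mean curvature of the basis -/

section MeanCurvature

variable {n : ℕ}

/-- The mean curvature of a pair consisting of the differential `A` of an immersion and the
differential `B` of its normal. -/
def traceForm (A B : Model n → Ambient n) : ℝ :=
  ∑ i, ∑ j, (Matrix.of fun i j => ⟪A (bv i), A (bv j)⟫ : Matrix (Fin n) (Fin n) ℝ)⁻¹ i j *
    ⟪B (bv i), A (bv j)⟫

open Matrix in
theorem traceForm_eq_trace (A B : Model n → Ambient n) : traceForm A B =
    Matrix.trace ((Matrix.of fun i j => ⟪A (bv i), A (bv j)⟫ : Matrix (Fin n) (Fin n) ℝ)⁻¹ *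
      (Matrix.of fun i j => ⟪B (bv i), A (bv j)⟫ : Matrix (Fin n) (Fin n) ℝ)ᵀ) := by
  simp [traceForm, Matrix.trace, Matrix.mul_apply]

theorem eq_sum_bv (v : Model n) : v = ∑ i, v i • bv i := by
  have := (EuclideanSpace.basisFun (Fin n) ℝ).sum_repr v
  simpa [bv] using this.symm

open Matrix in
theorem gram_comp (A B : Model n →ₗ[ℝ] Ambient n) (L : Model n →ₗ[ℝ] Model n) :
    (Matrix.of fun i j => ⟪B (L (bv i)), A (L (bv j))⟫ : Matrix (Fin n) (Fin n) ℝ) =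
      (Matrix.of fun i j => L (bv i) j) *
        (Matrix.of fun i j => ⟪B (bv i), A (bv j)⟫ : Matrix (Fin n) (Fin n) ℝ) *
        (Matrix.of fun i j => L (bv i) j)ᵀ := by
  ext i j
  simp only [Matrix.mul_apply, Matrix.of_apply, Matrix.transpose_apply, Finset.sum_mul]
  conv_lhs => rw [eq_sum_bv (L (bv i)), eq_sum_bv (L (bv j))]
  simp only [map_sum, map_smul, sum_inner, inner_sum, real_inner_smul_left, real_inner_smul_right]
  refine Finset.sum_congr rfl fun k _ => Finset.sum_congr rfl fun l _ => ?_
  ring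

theorem isUnit_det_of_injective {L : Model n →ₗ[ℝ] Model n} (hL : Function.Injective L) :
    IsUnit (Matrix.of fun i j => L (bv i) j : Matrix (Fin n) (Fin n) ℝ).det := by
  rw [isUnit_iff_ne_zero]
  intro h
  obtain ⟨v, hv, hv0⟩ := Matrix.exists_vecMul_eq_zero_iff.2 h
  apply hv
  have h1 : L (WithLp.toLp 2 v) = 0 := by
    rw [eq_sum_bv (WithLp.toLp 2 v)]
    ext j
    have := congrFun hv0 j
    simp only [Matrix.vecMul, dotProduct, Matrix.of_apply] at this
    simpa using this
  have h2 := hL (h1.trans (map_zero L).symm)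
  ext i
  exact congrFun (congrArg WithLp.ofLp h2) i

open Matrix in
/-- The mean curvature does not depend on the basis. -/
theorem traceForm_comp (A B : Model n →ₗ[ℝ] Ambient n) {L : Model n →ₗ[ℝ] Model n}
    (hL : Function.Injective L) :
    traceForm (fun v => A (L v)) (fun v => B (L v)) = traceForm A B := by
  have hM := isUnit_det_of_injective hL
  rw [traceForm_eq_trace, traceForm_eq_trace, gram_comp A A, gram_comp A B]
  set M : Matrix (Fin n) (Fin n) ℝ := Matrix.of fun i j => L (bv i) j with hMdef
  have hMt : IsUnit (Mᵀ).det := by rwa [Matrix.det_transpose]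
  rw [Matrix.mul_inv_rev, Matrix.mul_inv_rev, Matrix.transpose_mul, Matrix.transpose_mul,
    Matrix.transpose_transpose]
  set g := (Matrix.of fun i j => ⟪A (bv i), A (bv j)⟫ : Matrix (Fin n) (Fin n) ℝ)
  set k := (Matrix.of fun i j => ⟪B (bv i), A (bv j)⟫ : Matrix (Fin n) (Fin n) ℝ)
  have h1 : Mᵀ⁻¹ * (g⁻¹ * M⁻¹) * (M * (kᵀ * Mᵀ)) = Mᵀ⁻¹ * (g⁻¹ * kᵀ * Mᵀ) := by
    simp only [Matrix.mul_assoc]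
    rw [Matrix.nonsing_inv_mul_cancel_left M _ hM]
  rw [h1, Matrix.trace_mul_comm, Matrix.mul_assoc, Matrix.mul_nonsing_inv _ hMt, Matrix.mul_one]

end MeanCurvature

end IMCF
end

/-! ### Geometric quantities in a parametrisation -/

noncomputable section

namespace IMCF

section MatrixSmooth

variable {Z : Type*} [NormedAddCommGroup Z] [NormedSpace ℝ Z] {ι : Type*} [Fintype ι]
  [DecidableEq ι] {s : Set Z} {M : Z → Matrix ι ι ℝ}

theorem contDiffOn_det (h : ∀ i j, ContDiffOn ℝ ∞ (fun z => M z i j) s) :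
    ContDiffOn ℝ ∞ (fun z => (M z).det) s := by
  simp only [Matrix.det_apply']
  exact ContDiffOn.sum fun τ _ => contDiffOn_const.mul (contDiffOn_prod fun i _ => h _ _)

/-- By Cramer's rule the entries are quotients of determinants. -/
theorem contDiffOn_matrix_inv (h : ∀ i j, ContDiffOn ℝ ∞ (fun z => M z i j) s)
    (hd : ∀ z ∈ s, (M z).det ≠ 0) (i j : ι) : ContDiffOn ℝ ∞ (fun z => (M z)⁻¹ i j) s := by
  simp only [Matrix.inv_def, Ring.inverse_eq_inv', Matrix.smul_apply, Matrix.adjugate_apply,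
    smul_eq_mul]
  refine ((contDiffOn_det h).inv hd).mul (contDiffOn_det fun k l => ?_)
  simp only [Matrix.updateRow_apply]
  split_ifs
  · exact contDiffOn_const
  · exact h k l

end MatrixSmooth

/-- The range of `A` lies in the orthogonal complement of ν and has the same dimension n, so they
agree. Hence `q` is tangent and orthogonal to itself. -/
theorem eq_zero_of_orthogonal {n : ℕ} {A : Model n →ₗ[ℝ] Ambient n} (hA : Function.Injective A)
    {ν : Ambient n} (hν : ‖ν‖ = 1) (hνA : ∀ a, ⟪ν, A a⟫ = 0) {q : Ambient n} (hq : ⟪q, ν⟫ = 0)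
    (hqA : ∀ a, ⟪q, A a⟫ = 0) : q = 0 := by
  have hν0 : ν ≠ 0 := by rintro rfl; simp at hν
  have hle : LinearMap.range A ≤ (ℝ ∙ ν)ᗮ := by
    rintro _ ⟨a, rfl⟩
    rw [Submodule.mem_orthogonal_singleton_iff_inner_right]
    exact hνA a
  have : Fact (Module.finrank ℝ (Ambient n) = n + 1) := ⟨by simp⟩
  have heq : LinearMap.range A = (ℝ ∙ ν)ᗮ := by
    apply Submodule.eq_of_le_of_finrank_eq hle
    rw [LinearMap.finrank_range_of_inj hA, Submodule.finrank_orthogonal_span_singleton (n := n) hν0]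
    simp
  have hqm : q ∈ (ℝ ∙ ν)ᗮ := by
    rw [Submodule.mem_orthogonal_singleton_iff_inner_right, real_inner_comm]; exact hq
  rw [← heq] at hqm
  obtain ⟨a, rfl⟩ := hqm
  exact inner_self_eq_zero.1 (hqA a)

variable {n : ℕ}

/-- The differential of `X t ∘ σ` at `y`. -/
def tangentMap (X : ℝ → Sph n → Ambient n) (σ : Model n → Sph n) (z : ℝ × Model n) :
    Model n →L[ℝ] Ambient n :=
  fderiv ℝ (fun y => X z.1 (σ y)) z.2

/-- The matrix of the first fundamental form in the parametrisation `σ`. -/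
def paramGram (X : ℝ → Sph n → Ambient n) (σ : Model n → Sph n) (z : ℝ × Model n) :
    Matrix (Fin n) (Fin n) ℝ :=
  Matrix.of fun i j => ⟪tangentMap X σ z (bv i), tangentMap X σ z (bv j)⟫

/-- The matrix of the second fundamental form in the parametrisation `σ`. -/
def paramSecond (X ν : ℝ → Sph n → Ambient n) (σ : Model n → Sph n) (z : ℝ × Model n) :
    Matrix (Fin n) (Fin n) ℝ :=
  Matrix.of fun i j => ⟪tangentMap ν σ z (bv i), tangentMap X σ z (bv j)⟫

/-- The Weingarten matrix in the parametrisation `σ`. -/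
def paramWeingarten (X ν : ℝ → Sph n → Ambient n) (σ : Model n → Sph n) (z : ℝ × Model n) :
    Matrix (Fin n) (Fin n) ℝ :=
  paramSecond X ν σ z * (paramGram X σ z)⁻¹

section

variable {T : EReal} {X ν : ℝ → Sph n → Ambient n} (h : ImmersedFamily T X ν)
  {σ : Model n → Sph n} {U : Set (Model n)} (hσ : LocalParam σ U)
include h hσ

theorem tangentMap_apply {z : ℝ × Model n} (hz : z ∈ timeInterval T ×ˢ U) (a : Model n) :
    tangentMap X σ z a = modelDiff (X z.1) (σ z.2) (paramDiff σ z.2 a) := by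
  rw [tangentMap, (hasFDerivAt_param (contMDiff_slice h.smooth hz.1) hσ hz.2).fderiv]
  rfl

theorem tangentMap_normal_apply {z : ℝ × Model n} (hz : z ∈ timeInterval T ×ˢ U) (a : Model n) :
    tangentMap ν σ z a = modelDiff (ν z.1) (σ z.2) (paramDiff σ z.2 a) := by
  rw [tangentMap, (hasFDerivAt_param (contMDiff_slice h.smooth_normal hz.1) hσ hz.2).fderiv]
  rfl

theorem tangentMap_injective {z : ℝ × Model n} (hz : z ∈ timeInterval T ×ˢ U) :
    Function.Injective (tangentMap X σ z) := by
  intro a b hab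
  rw [tangentMap_apply h hσ hz, tangentMap_apply h hσ hz] at hab
  exact hσ.inj _ hz.2 (h.immersion _ hz.1 _ hab)

theorem inner_normal_tangentMap {z : ℝ × Model n} (hz : z ∈ timeInterval T ×ˢ U) (a : Model n) :
    ⟪ν z.1 (σ z.2), tangentMap X σ z a⟫ = 0 := by
  rw [tangentMap_apply h hσ hz]; exact h.normal _ hz.1 _ _

theorem inner_tangentMap_normal {z : ℝ × Model n} (hz : z ∈ timeInterval T ×ˢ U) (a : Model n) :
    ⟪tangentMap ν σ z a, ν z.1 (σ z.2)⟫ = 0 := by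
  have hd := (hasFDerivAt_param (contMDiff_slice h.smooth_normal hz.1) hσ hz.2).differentiableAt
  have h1 := fderiv_inner_apply ℝ hd hd a
  have h2 : (fun y => ⟪ν z.1 (σ y), ν z.1 (σ y)⟫) = fun _ => (1 : ℝ) := by
    ext y; rw [real_inner_self_eq_norm_sq, h.norm_normal _ hz.1]; norm_num
  rw [h2] at h1
  rw [real_inner_comm (ν z.1 (σ z.2))] at h1
  simp only [fderiv_fun_const, Pi.zero_apply, zero_apply] at h1
  rw [tangentMap, real_inner_comm]
  linarith

theorem paramGram_det_ne_zero {z : ℝ × Model n} (hz : z ∈ timeInterval T ×ˢ U) :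
    (paramGram X σ z).det ≠ 0 := by
  intro h0
  obtain ⟨v, hv, hv0⟩ := Matrix.exists_mulVec_eq_zero_iff.2 h0
  apply hv
  set A := tangentMap X σ z
  have h1 : ∀ i, ⟪A (bv i), A (WithLp.toLp 2 v)⟫ = 0 := fun i => by
    have := congrFun hv0 i
    simp only [Matrix.mulVec, dotProduct, paramGram, Matrix.of_apply] at this
    rw [eq_sum_bv (WithLp.toLp 2 v), map_sum, inner_sum]
    simpa [real_inner_smul_right, mul_comm] using this
  have h2 : ⟪A (WithLp.toLp 2 v), A (WithLp.toLp 2 v)⟫ = 0 := by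
    nth_rewrite 1 [eq_sum_bv (WithLp.toLp 2 v)]
    rw [map_sum, sum_inner]
    refine Finset.sum_eq_zero fun i _ => ?_
    rw [map_smul, real_inner_smul_left, h1, mul_zero]
  have h3 := tangentMap_injective h hσ hz ((inner_self_eq_zero.1 h2).trans (map_zero A).symm)
  ext i
  exact congrFun (congrArg WithLp.ofLp h3) i

theorem smooth_tangentMap (hT : 0 < T) (a : Model n) :
    ContDiffOn ℝ ∞ (fun z => tangentMap X σ z a) (timeInterval T ×ˢ U) :=
  contDiffOn_partial (uniqueDiffOn_timeInterval hT) hσ.isOpen (contDiffOn_param h.smooth hσ) a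

theorem smooth_tangentMap_normal (hT : 0 < T) (a : Model n) :
    ContDiffOn ℝ ∞ (fun z => tangentMap ν σ z a) (timeInterval T ×ˢ U) :=
  contDiffOn_partial (uniqueDiffOn_timeInterval hT) hσ.isOpen
    (contDiffOn_param h.smooth_normal hσ) a

theorem smooth_paramWeingarten (hT : 0 < T) (i j : Fin n) :
    ContDiffOn ℝ ∞ (fun z => paramWeingarten X ν σ z i j) (timeInterval T ×ˢ U) := by
  simp only [paramWeingarten, Matrix.mul_apply]
  refine ContDiffOn.sum fun k _ => ContDiffOn.mul ?_ ?_
  · exact (smooth_tangentMap_normal h hσ hT _).inner ℝ (smooth_tangentMap h hσ hT _)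
  · exact contDiffOn_matrix_inv (fun i j => (smooth_tangentMap h hσ hT _).inner ℝ
      (smooth_tangentMap h hσ hT _)) (fun z hz => paramGram_det_ne_zero h hσ hz) k j

/-- Both sides are orthogonal to ν and have equal products with all tangent vectors, so
`eq_zero_of_orthogonal` applies to their difference. -/
theorem tangentMap_normal_eq_sum {z : ℝ × Model n} (hz : z ∈ timeInterval T ×ˢ U) (i : Fin n) :
    tangentMap ν σ z (bv i) = ∑ j, paramWeingarten X ν σ z i j • tangentMap X σ z (bv j) := by
  rw [← sub_eq_zero]
  have hl : ∀ l, ⟪tangentMap ν σ z (bv i) -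
      ∑ j, paramWeingarten X ν σ z i j • tangentMap X σ z (bv j), tangentMap X σ z (bv l)⟫ = 0 :=
    fun l => by
    rw [inner_sub_left, sum_inner]
    simp only [real_inner_smul_left]
    have h1 : (paramWeingarten X ν σ z * paramGram X σ z) i l = paramSecond X ν σ z i l := by
      rw [paramWeingarten, Matrix.mul_assoc, Matrix.nonsing_inv_mul _
        (isUnit_iff_ne_zero.2 (paramGram_det_ne_zero h hσ hz)), Matrix.mul_one]
    rw [Matrix.mul_apply] at h1
    exact sub_eq_zero.2 h1.symm
  refine eq_zero_of_orthogonal (A := (tangentMap X σ z : Model n →ₗ[ℝ] Ambient n))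
    (tangentMap_injective h hσ hz) (h.norm_normal _ hz.1 (σ z.2))
    (fun a => inner_normal_tangentMap h hσ hz a) ?_ fun a => ?_
  · rw [inner_sub_left, sum_inner, inner_tangentMap_normal h hσ hz, zero_sub, neg_eq_zero]
    refine Finset.sum_eq_zero fun j _ => ?_
    rw [real_inner_smul_left, real_inner_comm, inner_normal_tangentMap h hσ hz, mul_zero]
  · rw [eq_sum_bv a, map_sum, inner_sum]
    refine Finset.sum_eq_zero fun l _ => ?_
    rw [map_smul, real_inner_smul_right]
    exact mul_eq_zero_of_right _ (hl l)

-- `meanCurv` uses a chart that varies with the point, which hides its smoothness. Basis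
-- independence transfers it to the single parametrisation σ.
open Matrix in
theorem meanCurv_param {z : ℝ × Model n} (hz : z ∈ timeInterval T ×ˢ U) :
    meanCurv (X z.1) (ν z.1) (σ z.2) = ∑ i, paramWeingarten X ν σ z i i := by
  set L : Model n →ₗ[ℝ] Model n := (paramDiff σ z.2 : Model n →ₗ[ℝ] Model n)
  set A : Model n →ₗ[ℝ] Ambient n := (modelDiff (X z.1) (σ z.2) : Model n →ₗ[ℝ] Ambient n)
  set B : Model n →ₗ[ℝ] Ambient n := (modelDiff (ν z.1) (σ z.2) : Model n →ₗ[ℝ] Ambient n)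
  have h1 : meanCurv (X z.1) (ν z.1) (σ z.2) = traceForm A B := rfl
  have hLi : Function.Injective L := hσ.inj _ hz.2
  have h2 : (fun v => A (L v)) = fun v => tangentMap X σ z v :=
    funext fun v => (tangentMap_apply h hσ hz v).symm
  have h3 : (fun v => B (L v)) = fun v => tangentMap ν σ z v :=
    funext fun v => (tangentMap_normal_apply h hσ hz v).symm
  rw [h1, ← traceForm_comp A B hLi, h2, h3, traceForm_eq_trace]
  change Matrix.trace ((paramGram X σ z)⁻¹ * (paramSecond X ν σ z)ᵀ) =
    Matrix.trace (paramSecond X ν σ z * (paramGram X σ z)⁻¹)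
  rw [← Matrix.trace_transpose, Matrix.transpose_mul, Matrix.transpose_transpose,
    Matrix.transpose_nonsing_inv]
  congr 3
  ext i j
  simp only [paramGram, Matrix.transpose_apply, Matrix.of_apply]
  rw [real_inner_comm]

theorem smooth_meanCurv_param (hT : 0 < T) :
    ContDiffOn ℝ ∞ (fun z : ℝ × Model n => meanCurv (X z.1) (ν z.1) (σ z.2))
      (timeInterval T ×ˢ U) :=
  (ContDiffOn.sum fun i _ => smooth_paramWeingarten h hσ hT i i).congr
    fun _ hz => meanCurv_param h hσ hz

/-- A graphical parametrisation at time `t₀` of a solution of inverse mean curvature flow. -/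
theorem graphFlow_of_param
    (hpos : ∀ t ∈ timeInterval T, ∀ x, 0 < meanCurv (X t) (ν t) x)
    (hflow : ∀ t ∈ timeInterval T, ∀ x,
      HasDerivWithinAt (fun s => X s x) ((1 / meanCurv (X t) (ν t) x) • ν t x) (timeInterval T) t)
    (h0 : (0 : Model n) ∈ U) {t₀ : ℝ} (ht₀ : t₀ ∈ timeInterval T) (ht₀' : 0 < t₀)
    (hgraph : ∀ y ∈ U, ∀ a c,
      ⟪tangentMap X σ (t₀, y) a, tangentMap X σ (t₀, 0) c⟫ = ⟪a, c⟫) :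
    GraphFlow (fun z : ℝ × Model n => X z.1 (σ z.2)) (fun z : ℝ × Model n => ν z.1 (σ z.2))
      (fun z : ℝ × Model n => meanCurv (X z.1) (ν z.1) (σ z.2))
      (fun i j z => paramWeingarten X ν σ z i j)
      ({t : ℝ | 0 < t ∧ (t : EReal) < T} ×ˢ U) t₀ := by
  have hT : 0 < T := lt_trans (by exact_mod_cast ht₀') ht₀.2
  have hsub : {t : ℝ | 0 < t ∧ (t : EReal) < T} ×ˢ U ⊆ timeInterval T ×ˢ U :=
    Set.prod_mono openTimeInterval_subset subset_rfl
  have hO : IsOpen ({t : ℝ | 0 < t ∧ (t : EReal) < T} ×ˢ U) :=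
    isOpen_openTimeInterval.prod hσ.isOpen
  have hF := (contDiffOn_param h.smooth hσ).mono hsub
  have hN := (contDiffOn_param h.smooth_normal hσ).mono hsub
  have hFd : ∀ z ∈ {t : ℝ | 0 < t ∧ (t : EReal) < T} ×ˢ U, ∀ a : Model n,
      dd (0, a) (fun z : ℝ × Model n => X z.1 (σ z.2)) z = tangentMap X σ z a := fun z hz a =>
    (fderiv_slice_eq_dd (hF.diffAt_of_isOpen hO hz) a).symm
  have hNd : ∀ z ∈ {t : ℝ | 0 < t ∧ (t : EReal) < T} ×ˢ U, ∀ a : Model n,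
      dd (0, a) (fun z : ℝ × Model n => ν z.1 (σ z.2)) z = tangentMap ν σ z a := fun z hz a =>
    (fderiv_slice_eq_dd (hN.diffAt_of_isOpen hO hz) a).symm
  have hmem : (t₀, (0 : Model n)) ∈ {t : ℝ | 0 < t ∧ (t : EReal) < T} ×ˢ U := ⟨⟨ht₀', ht₀.2⟩, h0⟩
  exact {
    isOpen := hO
    mem := hmem
    smoothF := hF
    smoothN := hN
    smoothH := (smooth_meanCurv_param h hσ hT).mono hsub
    smoothW := fun i j => (smooth_paramWeingarten h hσ hT i j).mono hsub
    norm := fun z hz => by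
      rw [real_inner_self_eq_norm_sq, h.norm_normal _ (hsub hz).1]; norm_num
    normal := fun z hz a => by
      rw [hFd z hz]; exact inner_normal_tangentMap h hσ (hsub hz) a
    weingarten := fun z hz i => by
      rw [hNd z hz, tangentMap_normal_eq_sum h hσ (hsub hz)]
      simp only [hFd z hz]
    trace := fun z hz => meanCurv_param h hσ (hsub hz)
    pos := fun z hz => hpos _ (hsub hz).1 _
    flow := fun z hz => by
      have h1 := hasDerivAt_time_dd (hF.diffAt_of_isOpen hO hz)
      have h2 := (hflow z.1 (hsub hz).1 (σ z.2)).hasDerivAt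
        (timeInterval_mem_nhds (hsub hz).1 hz.1.1)
      rw [h1.unique h2, one_div]
    isometric := fun a b => by
      rw [hFd _ hmem, hFd _ hmem]; exact hgraph 0 h0 a b
    -- By `hgraph` the product of ∂_a F with a fixed tangent vector at the origin is constant on the
    -- slice; its derivative vanishes.
    graph := fun y hy a b c => by
      have hFa := smooth_dd hO hF (0, a)
      have h1 := dd_congr_slice hO (hFa.inner ℝ (contDiffOn_const (c := dd (0, c)
          (fun z : ℝ × Model n => X z.1 (σ z.2)) (t₀, 0))))
        (contDiffOn_const (c := ⟪a, c⟫)) (t₀ := t₀) (fun y hy => by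
          rw [hFd _ hmem, hFd _ hy]; exact hgraph y hy.2 a c) b y hy
      rw [dd_inner hO hFa contDiffOn_const _ _ hy, dd_const, dd_const, inner_zero_right,
        add_zero] at h1
      exact h1
    span := fun q hq hqa => by
      refine eq_zero_of_orthogonal
        (A := (tangentMap X σ (t₀, 0) : Model n →ₗ[ℝ] Ambient n))
        (tangentMap_injective h hσ (hsub hmem)) (h.norm_normal _ ht₀ (σ 0))
        (fun a => inner_normal_tangentMap h hσ (hsub hmem) a) hq fun a => ?_
      have := hqa a
      rwa [hFd _ hmem] at this }

end

end IMCF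
end

/-! ### Graphical parametrisations exist -/

noncomputable section

namespace IMCF

theorem exists_isometry_orthogonal {n : ℕ} {ν : Ambient n} (hν : ‖ν‖ = 1) :
    ∃ e : Model n →ₗᵢ[ℝ] Ambient n, ∀ a, ⟪ν, e a⟫ = 0 := by
  have hν0 : ν ≠ 0 := by rintro rfl; simp at hν
  have : Fact (Module.finrank ℝ (Ambient n) = n + 1) := ⟨by simp⟩
  let b := OrthonormalBasis.fromOrthogonalSpanSingleton (𝕜 := ℝ) n hν0
  refine ⟨(ℝ ∙ ν)ᗮ.subtypeₗᵢ.comp b.repr.symm.toLinearIsometry, fun a => ?_⟩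
  exact Submodule.mem_orthogonal_singleton_iff_inner_right.1 (b.repr.symm a).2

/-- Local inversion of a smooth map with injective differential at `y₀`. -/
theorem exists_smooth_local_inverse {n : ℕ} {Φ : Model n → Model n} {U₀ : Set (Model n)}
    (hU₀ : IsOpen U₀) (hΦ : ContDiffOn ℝ ∞ Φ U₀) {y₀ : Model n} (hy₀ : y₀ ∈ U₀)
    (hinj : Function.Injective (fderiv ℝ Φ y₀)) :
    ∃ (ψ : Model n → Model n) (U : Set (Model n)), IsOpen U ∧ Φ y₀ ∈ U ∧ ψ (Φ y₀) = y₀ ∧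
      Set.MapsTo ψ U U₀ ∧ ContDiffOn ℝ ∞ ψ U ∧ ∀ y ∈ U, Φ (ψ y) = y := by
  have hd : ∀ y ∈ U₀, HasFDerivAt Φ (fderiv ℝ Φ y) y := fun y hy =>
    (hΦ.diffAt_of_isOpen hU₀ hy).hasFDerivAt
  let L : Model n ≃L[ℝ] Model n :=
    (LinearEquiv.ofInjectiveEndo (fderiv ℝ Φ y₀ : Model n →ₗ[ℝ] Model n)
      hinj).toContinuousLinearEquiv
  have hL : (L : Model n →L[ℝ] Model n) = fderiv ℝ Φ y₀ := by ext; rfl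
  have hc : ContDiffAt ℝ ∞ Φ y₀ := hΦ.contDiffAt (hU₀.mem_nhds hy₀)
  have hL' : HasFDerivAt Φ (L : Model n →L[ℝ] Model n) y₀ := hL ▸ hd y₀ hy₀
  let θ := hc.toOpenPartialHomeomorph Φ hL' (by simp)
  have hθ : ∀ y, θ y = Φ y := fun y => rfl
  have hsrc : y₀ ∈ θ.source := hc.mem_toOpenPartialHomeomorph_source hL' (by simp)
  -- Invertible operators form an open set. Shrinking to where the differential of Φ is invertible
  -- makes the inverse smooth on a whole neighbourhood, not only at Φ y₀.
  let S : Set (Model n →L[ℝ] Model n) :=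
    Set.range ((↑) : (Model n ≃L[ℝ] Model n) → Model n →L[ℝ] Model n)
  have hV : IsOpen (U₀ ∩ fderiv ℝ Φ ⁻¹' S) :=
    (hΦ.continuousOn_fderiv_of_isOpen hU₀ (by simp)).isOpen_inter_preimage hU₀
      ContinuousLinearEquiv.isOpen
  refine ⟨θ.symm, θ.target ∩ θ.symm ⁻¹' (U₀ ∩ fderiv ℝ Φ ⁻¹' S),
    θ.symm.isOpen_inter_preimage hV, ?_, ?_, ?_, ?_, ?_⟩
  · rw [← hθ]
    refine ⟨θ.map_source hsrc, ?_⟩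
    rw [Set.mem_preimage, θ.left_inv hsrc]
    exact ⟨hy₀, L, hL⟩
  · rw [← hθ]; exact θ.left_inv hsrc
  · exact fun y hy => hy.2.1
  · intro y hy
    obtain ⟨M, hM⟩ := hy.2.2
    refine (θ.contDiffAt_symm hy.1 (f₀' := M) ?_
      (hΦ.contDiffAt (hU₀.mem_nhds hy.2.1))).contDiffWithinAt
    rw [hM]; exact hd _ hy.2.1
  · intro y hy
    rw [← hθ]; exact θ.right_inv hy.1

theorem LocalParam.comp {n : ℕ} {κ : Model n → Sph n} {U₀ : Set (Model n)} (hκ : LocalParam κ U₀)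
    {ψ : Model n → Model n} {U : Set (Model n)} (hU : IsOpen U) (hψ : ContDiffOn ℝ ∞ ψ U)
    (hm : Set.MapsTo ψ U U₀) (hinj : ∀ y ∈ U, Function.Injective (fderiv ℝ ψ y)) :
    LocalParam (fun y => κ (ψ y)) U where
  isOpen := hU
  smooth := hκ.smooth.comp hψ.contMDiffOn hm
  inj := fun y hy => by
    have h1 : HasMFDerivAt 𝓘(ℝ, Model n) (𝓡 n) κ (ψ y)
        (mfderiv 𝓘(ℝ, Model n) (𝓡 n) κ (ψ y)) :=
      ((hκ.smooth.contMDiffAt (hκ.isOpen.mem_nhds (hm hy))).mdifferentiableAt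
        (by simp)).hasMFDerivAt
    have h2 : HasMFDerivAt 𝓘(ℝ, Model n) 𝓘(ℝ, Model n) ψ y (fderiv ℝ ψ y) :=
      (hψ.diffAt_of_isOpen hU hy).hasFDerivAt.hasMFDerivAt
    have h3 := (h1.comp y h2).mfderiv
    have h4 : paramDiff (fun y => κ (ψ y)) y = (paramDiff κ (ψ y)).comp (fderiv ℝ ψ y) := h3
    rw [h4]
    exact (hκ.inj _ (hm hy)).comp (hinj y hy)

/-- Around any point, the hypersurface at time `t₀` can be parametrised as a graph over its tangent
space at that point. -/
theorem exists_graph_param {n : ℕ} {T : EReal} {X ν : ℝ → Sph n → Ambient n}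
    (h : ImmersedFamily T X ν) {t₀ : ℝ} (ht₀ : t₀ ∈ timeInterval T) (x₀ : Sph n) :
    ∃ (σ : Model n → Sph n) (U : Set (Model n)), LocalParam σ U ∧ 0 ∈ U ∧ σ 0 = x₀ ∧
      ∀ y ∈ U, ∀ a c, ⟪tangentMap X σ (t₀, y) a, tangentMap X σ (t₀, 0) c⟫ = ⟪a, c⟫ := by
  obtain ⟨e, he⟩ := exists_isometry_orthogonal (h.norm_normal t₀ ht₀ x₀)
  set κ : Model n → Sph n := fun y => (extChartAt (𝓡 n) x₀).symm y with hκdef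
  set U₀ : Set (Model n) := (extChartAt (𝓡 n) x₀).target with hU₀def
  have hκ : LocalParam κ U₀ := localParam_extChartAt x₀
  set y₀ : Model n := extChartAt (𝓡 n) x₀ x₀ with hy₀def
  have hy₀ : y₀ ∈ U₀ := mem_extChartAt_target x₀
  have hκy₀ : κ y₀ = x₀ := extChartAt_to_inv x₀
  set f : Model n → Ambient n := fun y => X t₀ (κ y) with hf
  have hfs : ContDiffOn ℝ ∞ f U₀ := by
    have h1 : ContDiffOn ℝ ∞ (fun y : Model n => (t₀, y)) U₀ :=
      (contDiff_const.prodMk contDiff_id).contDiffOn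
    exact (contDiffOn_param h.smooth hκ).comp h1 fun y hy => ⟨ht₀, hy⟩
  -- `P` is the orthogonal projection to the tangent plane at x₀ in the coordinates of `e`.
  -- Inverting Φ, the tangential position of X(·, t₀), yields the graph coordinates.
  set P : Ambient n →L[ℝ] Model n := ContinuousLinearMap.adjoint e.toContinuousLinearMap with hP
  have hPe : ∀ q a, ⟪P q, a⟫ = ⟪q, e a⟫ := fun q a =>
    ContinuousLinearMap.adjoint_inner_left _ _ _
  have hortho : ∀ q : Ambient n, ⟪q, ν t₀ x₀⟫ = 0 → P q = 0 → q = 0 := fun q hq hPq =>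
    eq_zero_of_orthogonal (A := e.toLinearMap) e.injective (h.norm_normal t₀ ht₀ x₀) he hq
      fun a => by
        have := hPe q a
        rw [hPq, inner_zero_left] at this
        exact this.symm
  set Φ : Model n → Model n := fun y => P (f y - f y₀) with hΦdef
  have hΦ : ContDiffOn ℝ ∞ Φ U₀ := P.contDiff.comp_contDiffOn (hfs.sub contDiffOn_const)
  have hfd : ∀ y ∈ U₀, HasFDerivAt f (fderiv ℝ f y) y := fun y hy =>
    (hfs.diffAt_of_isOpen hκ.isOpen hy).hasFDerivAt
  have hΦd : fderiv ℝ Φ y₀ = P.comp (fderiv ℝ f y₀) :=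
    (P.hasFDerivAt.comp y₀ ((hfd y₀ hy₀).sub_const _)).fderiv
  have hz₀ : (t₀, y₀) ∈ timeInterval T ×ˢ U₀ := ⟨ht₀, hy₀⟩
  have hinj : Function.Injective (fderiv ℝ Φ y₀) := by
    rw [injective_iff_map_eq_zero]
    intro a ha
    rw [hΦd] at ha
    have h1 : tangentMap X κ (t₀, y₀) a = 0 := by
      refine hortho _ ?_ ha
      have := inner_normal_tangentMap h hκ hz₀ a
      rw [real_inner_comm]
      simpa only [hκy₀] using this
    exact tangentMap_injective h hκ hz₀ (h1.trans (map_zero _).symm)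
  obtain ⟨ψ, U, hU, hmem, hψ₀, hmaps, hψ, hinv⟩ :=
    exists_smooth_local_inverse hκ.isOpen hΦ hy₀ hinj
  have hΦ0 : Φ y₀ = 0 := by simp [hΦdef]
  rw [hΦ0] at hmem hψ₀
  have hψd : ∀ y ∈ U, HasFDerivAt ψ (fderiv ℝ ψ y) y := fun y hy =>
    (hψ.diffAt_of_isOpen hU hy).hasFDerivAt
  have hid : ∀ y ∈ U, ∀ a, P (tangentMap X (fun y => κ (ψ y)) (t₀, y) a) = a := fun y hy a => by
    have h1 : HasFDerivAt (fun y => f (ψ y)) _ y := (hfd _ (hmaps hy)).comp y (hψd y hy)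
    have h2 : HasFDerivAt (fun y => P (f (ψ y) - f y₀)) _ y :=
      P.hasFDerivAt.comp y (h1.sub_const (f y₀))
    have h3 : (fun y => P (f (ψ y) - f y₀)) =ᶠ[𝓝 y] id :=
      Filter.eventuallyEq_of_mem (hU.mem_nhds hy) fun y hy => hinv y hy
    have h4 := h2.fderiv
    rw [h3.fderiv_eq, fderiv_id, ← h1.fderiv] at h4
    exact (congrArg (fun M : Model n →L[ℝ] Model n => M a) h4).symm
  have hψinj : ∀ y ∈ U, Function.Injective (fderiv ℝ ψ y) := fun y hy => by
    have h1 : tangentMap X (fun y => κ (ψ y)) (t₀, y) = (fderiv ℝ f (ψ y)).comp (fderiv ℝ ψ y) :=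
      ((hfd _ (hmaps hy)).comp y (hψd y hy)).fderiv
    intro a b hab
    rw [← hid y hy a, ← hid y hy b, h1]
    simp [hab]
  have hσ : LocalParam (fun y => κ (ψ y)) U := hκ.comp hU hψ hmaps hψinj
  have hσ0 : κ (ψ 0) = x₀ := by rw [hψ₀, hκy₀]
  refine ⟨fun y => κ (ψ y), U, hσ, hmem, hσ0, fun y hy a c => ?_⟩
  -- At the origin the tangent vector lies in the plane itself, so its projection determines it.
  have h1 : tangentMap X (fun y => κ (ψ y)) (t₀, 0) c = e c := by
    rw [← sub_eq_zero]
    apply hortho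
    · have h2 := inner_normal_tangentMap h hσ (z := (t₀, 0)) ⟨ht₀, hmem⟩ c
      simp only [hσ0] at h2
      rw [inner_sub_left, real_inner_comm, h2, real_inner_comm, he, sub_zero]
    · rw [map_sub, hid 0 hmem, sub_eq_zero]
      refine ext_inner_right ℝ fun b => ?_
      rw [hPe, e.inner_map_map]
  rw [h1, ← hPe, hid y hy]

end IMCF
end

/-! ### Strict pinching in space-time -/

noncomputable section

namespace IMCF

variable {n : ℕ} {T : EReal} {X ν : ℝ → Sph n → Ambient n}

/-- The strict version of the pinching inequality at a point. -/
def StrictlyPinchedAt (X ν : Sph n → Ambient n) (ε : ℝ) (x : Sph n) : Prop :=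
  ∀ v : Tan x, v ≠ 0 → ε * meanCurv X ν x * firstForm X x v v < secondForm X ν x v v

/-- The pinching form in the parametrisation `σ`. -/
def paramPinch (X ν : ℝ → Sph n → Ambient n) (σ : Model n → Sph n) (e : ℝ) (z : ℝ × Model n)
    (a : Model n) : ℝ :=
  ⟪tangentMap ν σ z a, tangentMap X σ z a⟫ -
    e * meanCurv (X z.1) (ν z.1) (σ z.2) * ⟪tangentMap X σ z a, tangentMap X σ z a⟫

theorem firstForm_pos {F : Sph n → Ambient n} {x : Sph n} (hF : Function.Injective (diff F x))
    {v : Tan x} (hv : v ≠ 0) : 0 < firstForm F x v v := by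
  refine real_inner_self_pos.2 fun h0 => hv (hF (h0.trans (map_zero _).symm))

theorem paramPinch_smul (σ : Model n → Sph n) (e : ℝ) (z : ℝ × Model n) (r : ℝ) (a : Model n) :
    paramPinch X ν σ e z (r • a) = r ^ 2 * paramPinch X ν σ e z a := by
  simp only [paramPinch, map_smul, real_inner_smul_left, real_inner_smul_right]
  ring

section Param

variable (h : ImmersedFamily T X ν) {σ : Model n → Sph n} {U : Set (Model n)}
  (hσ : LocalParam σ U)
include h hσ

theorem paramPinch_eq {z : ℝ × Model n} (hz : z ∈ timeInterval T ×ˢ U) (e : ℝ) (a : Model n) :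
    paramPinch X ν σ e z a =
      secondForm (X z.1) (ν z.1) (σ z.2) (paramDiff σ z.2 a) (paramDiff σ z.2 a) -
        e * meanCurv (X z.1) (ν z.1) (σ z.2) *
          firstForm (X z.1) (σ z.2) (paramDiff σ z.2 a) (paramDiff σ z.2 a) := by
  rw [paramPinch, tangentMap_apply h hσ hz, tangentMap_normal_apply h hσ hz]
  rfl

theorem strictlyPinchedAt_iff {z : ℝ × Model n} (hz : z ∈ timeInterval T ×ˢ U) (e : ℝ) :
    StrictlyPinchedAt (X z.1) (ν z.1) e (σ z.2) ↔ ∀ a, a ≠ 0 → 0 < paramPinch X ν σ e z a := by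
  have hinj := hσ.inj _ hz.2
  have hsurj : Function.Surjective (paramDiff σ z.2) :=
    (LinearMap.injective_iff_surjective (f := (paramDiff σ z.2 : Model n →ₗ[ℝ] Model n))).1 hinj
  constructor
  · intro hs a ha
    rw [paramPinch_eq h hσ hz, sub_pos]
    exact hs _ fun h0 => ha (hinj (h0.trans (map_zero (paramDiff σ z.2)).symm))
  · intro hs v hv
    obtain ⟨a, rfl⟩ := hsurj v
    have ha : a ≠ 0 := by rintro rfl; exact hv (map_zero (paramDiff σ z.2))
    have := hs a ha
    rwa [paramPinch_eq h hσ hz, sub_pos] at this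

theorem continuousOn_paramPinch (hT : 0 < T) {e : ℝ → ℝ} (he : Continuous e) :
    ContinuousOn (fun p : (ℝ × Model n) × Model n => paramPinch X ν σ (e p.1.1) p.1 p.2)
      ((timeInterval T ×ˢ U) ×ˢ Set.univ) := by
  have hm : Set.MapsTo (Prod.fst : (ℝ × Model n) × Model n → ℝ × Model n)
      ((timeInterval T ×ˢ U) ×ˢ Set.univ) (timeInterval T ×ˢ U) := fun p hp => hp.1
  have hA : ∀ G : ℝ → Sph n → Ambient n,
      (∀ i : Fin n, ContDiffOn ℝ ∞ (fun z => tangentMap G σ z (bv i)) (timeInterval T ×ˢ U)) →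
      ContinuousOn (fun p : (ℝ × Model n) × Model n => tangentMap G σ p.1 p.2)
        ((timeInterval T ×ˢ U) ×ˢ Set.univ) := fun G hG => by
    have : (fun p : (ℝ × Model n) × Model n => tangentMap G σ p.1 p.2) =
        fun p => ∑ i, p.2 i • tangentMap G σ p.1 (bv i) := by
      ext1 p
      conv_lhs => rw [eq_sum_bv p.2]
      simp only [map_sum, map_smul]
    rw [this]
    refine continuousOn_finsetSum _ fun i _ => ?_
    have h1 : Continuous fun p : (ℝ × Model n) × Model n => p.2 i := by fun_prop
    exact h1.continuousOn.smul ((hG i).continuousOn.comp continuousOn_fst hm)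
  have hX := hA X fun i => smooth_tangentMap h hσ hT _
  have hν := hA ν fun i => smooth_tangentMap_normal h hσ hT _
  have hH : ContinuousOn (fun p : (ℝ × Model n) × Model n =>
      meanCurv (X p.1.1) (ν p.1.1) (σ p.1.2)) ((timeInterval T ×ˢ U) ×ˢ Set.univ) :=
    (smooth_meanCurv_param h hσ hT).continuousOn.comp continuousOn_fst hm
  exact (hν.inner hX).sub (((he.comp (by fun_prop)).continuousOn.mul hH).mul (hX.inner hX))

/-- Positivity is open near each unit vector, compactness of the unit sphere makes the neighbourhood
uniform, and homogeneity of degree 2 gives all nonzero vectors. -/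
theorem eventually_paramPinch_pos (hT : 0 < T) {e : ℝ → ℝ} (he : Continuous e) {z : ℝ × Model n}
    (hz : z ∈ timeInterval T ×ˢ U)
    (hpos : ∀ a, a ≠ 0 → 0 < paramPinch X ν σ (e z.1) z a) :
    ∀ᶠ w in 𝓝[timeInterval T ×ˢ U] z, ∀ a, a ≠ 0 → 0 < paramPinch X ν σ (e w.1) w a := by
  have hc := continuousOn_paramPinch h hσ hT he
  have key : ∀ᶠ w in 𝓝 z, ∀ a ∈ Metric.sphere (0 : Model n) 1,
      w ∈ timeInterval T ×ˢ U → 0 < paramPinch X ν σ (e w.1) w a := by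
    refine (isCompact_sphere (0 : Model n) 1).eventually_forall_of_forall_eventually fun a ha => ?_
    have ha0 : a ≠ 0 := by rintro rfl; simp at ha
    have h1 := (hc (z, a) ⟨hz, trivial⟩).eventually (lt_mem_nhds (hpos a ha0))
    rw [eventually_nhdsWithin_iff] at h1
    exact h1.mono fun p hp hp1 => hp ⟨hp1, trivial⟩
  rw [eventually_nhdsWithin_iff]
  refine key.mono fun w hw hwU a ha => ?_
  have hn : ‖a‖ ≠ 0 := norm_ne_zero_iff.2 ha
  have h2 := hw (‖a‖⁻¹ • a) (by simp [norm_smul, hn]) hwU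
  rw [paramPinch_smul] at h2
  exact pos_of_mul_pos_right h2 (by positivity)

end Param

/-- Points near `(t, x)` in space-time are near the image of `(t, x)` in the chart. -/
theorem tendsto_chart {t : ℝ} (x : Sph n) (I : Set ℝ) :
    Filter.Tendsto (fun p : ℝ × Sph n => (p.1, extChartAt (𝓡 n) x p.2)) (𝓝[I ×ˢ Set.univ] (t, x))
      (𝓝[I ×ˢ (extChartAt (𝓡 n) x).target] (t, extChartAt (𝓡 n) x x)) := by
  have hc : ContinuousAt (fun p : ℝ × Sph n => (p.1, extChartAt (𝓡 n) x p.2)) (t, x) :=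
    continuousAt_fst.prodMk
      ((continuousAt_extChartAt (I := 𝓡 n) x).comp (f := Prod.snd) (x := (t, x)) continuousAt_snd)
  refine tendsto_nhdsWithin_iff.2 ⟨hc.tendsto.mono_left nhdsWithin_le_nhds, ?_⟩
  have hs : ∀ᶠ p : ℝ × Sph n in 𝓝[I ×ˢ Set.univ] (t, x), p.2 ∈ (extChartAt (𝓡 n) x).source :=
    nhdsWithin_le_nhds (continuousAt_snd (extChartAt_source_mem_nhds (I := 𝓡 n) x))
  filter_upwards [hs, self_mem_nhdsWithin] with p hp hp'
  exact ⟨hp'.1, (extChartAt (𝓡 n) x).map_source hp⟩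

theorem eventually_chart_inv {t : ℝ} (x : Sph n) (I : Set ℝ) :
    ∀ᶠ p : ℝ × Sph n in 𝓝[I ×ˢ Set.univ] (t, x),
      (extChartAt (𝓡 n) x).symm (extChartAt (𝓡 n) x p.2) = p.2 := by
  have hs : ∀ᶠ p : ℝ × Sph n in 𝓝[I ×ˢ Set.univ] (t, x), p.2 ∈ (extChartAt (𝓡 n) x).source :=
    nhdsWithin_le_nhds (continuousAt_snd (extChartAt_source_mem_nhds (I := 𝓡 n) x))
  exact hs.mono fun p hp => (extChartAt (𝓡 n) x).left_inv hp

/-! ### Openness, bounds and first failure on the whole sphere -/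

section Global

variable (h : ImmersedFamily T X ν) (hT : 0 < T)
include h hT

theorem eventually_strictlyPinchedAt {e : ℝ → ℝ} (he : Continuous e) {t : ℝ}
    (ht : t ∈ timeInterval T) {x : Sph n} (hp : StrictlyPinchedAt (X t) (ν t) (e t) x) :
    ∀ᶠ p : ℝ × Sph n in 𝓝[timeInterval T ×ˢ Set.univ] (t, x),
      StrictlyPinchedAt (X p.1) (ν p.1) (e p.1) p.2 := by
  have hσ := localParam_extChartAt x
  have hz : (t, extChartAt (𝓡 n) x x) ∈ timeInterval T ×ˢ (extChartAt (𝓡 n) x).target :=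
    ⟨ht, mem_extChartAt_target x⟩
  have hpos := (strictlyPinchedAt_iff h hσ hz (e t)).1 (by
    simpa only [extChartAt_to_inv] using hp)
  have h1 := (tendsto_chart x (timeInterval T)).eventually
    (eventually_paramPinch_pos h hσ hT he hz hpos)
  filter_upwards [h1, eventually_chart_inv x (timeInterval T),
    (tendsto_chart x (timeInterval T)).eventually self_mem_nhdsWithin] with p hp1 hp2 hp3
  have h2 := (strictlyPinchedAt_iff h hσ hp3 (e p.1)).2 hp1
  simpa only [hp2] using h2

theorem continuousOn_meanCurv (x : Sph n) :
    ContinuousOn (fun t => meanCurv (X t) (ν t) x) (timeInterval T) := by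
  have hσ := localParam_extChartAt x
  have h1 : ContinuousOn (fun t : ℝ => (t, extChartAt (𝓡 n) x x)) (timeInterval T) := by fun_prop
  have h2 := (smooth_meanCurv_param h hσ hT).continuousOn.comp h1
    fun t ht => ⟨ht, mem_extChartAt_target x⟩
  refine h2.congr fun t _ => ?_
  simp only [Function.comp_apply, extChartAt_to_inv]

/-- The mean curvature at a fixed point is continuous in time and never zero, so it keeps its
initial sign. -/
theorem meanCurv_pos (hne : ∀ t ∈ timeInterval T, ∀ x, meanCurv (X t) (ν t) x ≠ 0)
    (h0 : ∀ x, 0 < meanCurv (X 0) (ν 0) x) : ∀ t ∈ timeInterval T, ∀ x,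
      0 < meanCurv (X t) (ν t) x := by
  intro t ht x
  by_contra! hle
  have hz : (0 : ℝ) ∈ timeInterval T := ⟨le_rfl, by exact_mod_cast hT⟩
  obtain ⟨s, hs, hs0⟩ := convex_timeInterval.isPreconnected.intermediate_value ht hz
    (continuousOn_meanCurv h hT x) ⟨hle, (h0 x).le⟩
  exact hne s hs x hs0

theorem continuousOn_derivWithin_normal :
    ContinuousOn (fun p : ℝ × Sph n => derivWithin (fun s => ν s p.2) (timeInterval T) p.1)
      (timeInterval T ×ˢ Set.univ) := by
  rintro ⟨t, x⟩ ⟨ht, -⟩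
  have hσ := localParam_extChartAt x
  have hu := (uniqueDiffOn_timeInterval hT).prod hσ.isOpen.uniqueDiffOn
  set σ : Model n → Sph n := fun y => (extChartAt (𝓡 n) x).symm y with hσdef
  set U := (extChartAt (𝓡 n) x).target
  have hN : ContDiffOn ℝ ∞ (fun z : ℝ × Model n => ν z.1 (σ z.2)) (timeInterval T ×ˢ U) :=
    contDiffOn_param h.smooth_normal hσ
  have hz : (t, extChartAt (𝓡 n) x x) ∈ timeInterval T ×ˢ U := ⟨ht, mem_extChartAt_target x⟩
  have hc := (hN.continuousOn_fderivWithin hu (by simp) _ hz).clm_apply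
    (continuousWithinAt_const (b := ((1 : ℝ), (0 : Model n))))
  have hd : ∀ z ∈ timeInterval T ×ˢ U,
      fderivWithin ℝ (fun z : ℝ × Model n => ν z.1 (σ z.2)) (timeInterval T ×ˢ U) z (1, 0) =
        derivWithin (fun s => ν s (σ z.2)) (timeInterval T) z.1 := fun z hz => by
    have h1 := (hN.differentiableOn (by simp) z hz).hasFDerivWithinAt
    have h2 : HasDerivWithinAt (fun s : ℝ => (s, z.2)) ((1 : ℝ), (0 : Model n)) (timeInterval T)
        z.1 := ((hasDerivAt_id z.1).prodMk (hasDerivAt_const z.1 z.2)).hasDerivWithinAt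
    have h3 := HasFDerivWithinAt.comp_hasDerivWithinAt z.1 h1 h2
      (show Set.MapsTo (fun s : ℝ => (s, z.2)) (timeInterval T) (timeInterval T ×ˢ U) from
        fun s hs => ⟨hs, hz.2⟩)
    exact (h3.derivWithin (uniqueDiffOn_timeInterval hT _ hz.1)).symm
  have h4 := hc.tendsto.comp (tendsto_chart (t := t) x (timeInterval T))
  have hinv := eventually_chart_inv (t := t) x (timeInterval T)
  have hmem := (tendsto_chart (t := t) x (timeInterval T)).eventually self_mem_nhdsWithin
  have h5 : Filter.Tendsto
      (fun p : ℝ × Sph n => derivWithin (fun s => ν s p.2) (timeInterval T) p.1)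
      (𝓝[timeInterval T ×ˢ Set.univ] (t, x)) _ := h4.congr' (by
    filter_upwards [hinv, hmem] with p hp hp'
    simp only [Function.comp_apply]
    rw [hd _ hp']
    simp only [hσdef, hp])
  rw [hd _ hz] at h5
  simpa only [ContinuousWithinAt, hσdef, extChartAt_to_inv] using h5

/-- This supplies the uniform bound on the gradient terms `b` of `pinching_speed`. -/
theorem exists_bound_deriv_normal {t₁ : ℝ} (ht₁ : t₁ ∈ timeInterval T) :
    ∃ C : ℝ, ∀ t ∈ Set.Icc 0 t₁, ∀ x,
      ‖derivWithin (fun s => ν s x) (timeInterval T) t‖ ≤ C := by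
  have hsub : Set.Icc 0 t₁ ⊆ timeInterval T := fun t ht =>
    ⟨ht.1, lt_of_le_of_lt (by exact_mod_cast ht.2) ht₁.2⟩
  have hc : IsCompact (Set.Icc (0 : ℝ) t₁ ×ˢ (Set.univ : Set (Sph n))) :=
    isCompact_Icc.prod isCompact_univ
  obtain ⟨C, hC⟩ := hc.exists_bound_of_continuousOn
    ((continuousOn_derivWithin_normal h hT).mono (Set.prod_mono hsub subset_rfl))
  exact ⟨C, fun t ht x => hC (t, x) ⟨ht, trivial⟩⟩

/-- If strict pinching fails on `[0, t₁]`, there is a first time at which it fails. -/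
theorem exists_first_failure {e : ℝ → ℝ} (he : Continuous e) {t₁ : ℝ} (ht₁ : t₁ ∈ timeInterval T)
    {t : ℝ} (ht : t ∈ Set.Icc 0 t₁) {x : Sph n}
    (hx : ¬ StrictlyPinchedAt (X t) (ν t) (e t) x) :
    ∃ t₀ ∈ Set.Icc 0 t₁, ∃ x₀, ¬ StrictlyPinchedAt (X t₀) (ν t₀) (e t₀) x₀ ∧
      ∀ s, 0 ≤ s → s < t₀ → ∀ x, StrictlyPinchedAt (X s) (ν s) (e s) x := by
  have hsub : Set.Icc 0 t₁ ⊆ timeInterval T := fun t ht =>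
    ⟨ht.1, lt_of_le_of_lt (by exact_mod_cast ht.2) ht₁.2⟩
  set K : Set (ℝ × Sph n) := {p | p ∈ Set.Icc 0 t₁ ×ˢ Set.univ ∧
    ¬ StrictlyPinchedAt (X p.1) (ν p.1) (e p.1) p.2} with hK
  have hc : IsCompact (Set.Icc (0 : ℝ) t₁ ×ˢ (Set.univ : Set (Sph n))) :=
    isCompact_Icc.prod isCompact_univ
  have hclosed : IsClosed K := by
    rw [← isOpen_compl_iff, isOpen_iff_mem_nhds]
    intro p hp
    by_cases hp1 : p ∈ Set.Icc 0 t₁ ×ˢ (Set.univ : Set (Sph n))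
    · have hp2 : StrictlyPinchedAt (X p.1) (ν p.1) (e p.1) p.2 := by
        by_contra h2; exact hp ⟨hp1, h2⟩
      have h3 := eventually_strictlyPinchedAt h hT he (hsub hp1.1) hp2
      rw [eventually_nhdsWithin_iff] at h3
      filter_upwards [h3] with q hq hqK
      exact hqK.2 (hq ⟨hsub hqK.1.1, trivial⟩)
    · filter_upwards [hc.isClosed.isOpen_compl.mem_nhds hp1] with q hq hqK
      exact hq hqK.1
  have hKc : IsCompact K := hc.of_isClosed_subset hclosed fun p hp => hp.1
  obtain ⟨p, hp, hmin⟩ := hKc.exists_isMinOn ⟨(t, x), ⟨ht, trivial⟩, hx⟩ continuous_fst.continuousOn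
  refine ⟨p.1, hp.1.1, p.2, hp.2, fun s hs hsp x => ?_⟩
  by_contra hns
  have : p.1 ≤ s := hmin (show (s, x) ∈ K from ⟨⟨⟨hs, hsp.le.trans hp.1.1.2⟩, trivial⟩, hns⟩)
  linarith

end Global

end IMCF
end

/-! ### Preservation of pinching -/

noncomputable section

namespace IMCF

theorem hasDerivAt_pinchFun (n : ℕ) (α t : ℝ) :
    HasDerivAt (pinchFun n α) (α * (1 / n - pinchFun n α t)) t := by
  have h1 : HasDerivAt (fun t => Real.exp (-α * t)) (Real.exp (-α * t) * -α) t := by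
    simpa using ((hasDerivAt_id t).const_mul (-α)).exp
  refine ((h1.const_mul (1 / (n : ℝ) - α / 2)).const_sub (1 / (n : ℝ))).congr_deriv ?_
  simp only [pinchFun]
  ring

theorem pinchFun_bounds {n : ℕ} {α t : ℝ} (hα₀ : 0 ≤ α) (hα₁ : α / 2 ≤ 1 / (n : ℝ)) (ht : 0 ≤ t) :
    α / 2 ≤ pinchFun n α t ∧ pinchFun n α t ≤ 1 / n := by
  have h1 : Real.exp (-α * t) ≤ 1 := Real.exp_le_one_iff.2 (by nlinarith)
  have h2 := Real.exp_pos (-α * t)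
  constructor <;> simp only [pinchFun] <;> nlinarith

/-- The ordinary differential inequality that rules out a first failure of strict pinching for the
perturbed pinching function `ε - η`. -/
theorem barrier_contradiction {n : ℕ} (hn : 1 ≤ n) {α ε η A b C B : ℝ} (hα : 0 ≤ α)
    (hε₀ : α / 2 ≤ ε) (hε₁ : ε ≤ 1 / n) (hη : 0 < η) (hA : 1 / n ≤ A)
    (hA' : A ≤ (n + 2) ^ 2) (hη₁ : η ≤ 1) (hb : 0 ≤ b) (hb' : b ≤ B)
    (hC : 2 * (((n : ℝ) + 2) ^ 2 + 1) + B + 3 ≤ C)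
    (hODE : 2 * (ε - η) * (A - (ε - η)) + (ε - η) * b ≤ α * (1 / n - ε) - C * η) : False := by
  have hn1 : 1 / (n : ℝ) ≤ 1 := by
    rw [div_le_one (by positivity)]; exact_mod_cast hn
  generalize 1 / (n : ℝ) = m at *
  have hn2 : (0 : ℝ) ≤ ((n : ℝ) + 2) ^ 2 := by positivity
  generalize ((n : ℝ) + 2) ^ 2 = K at *
  rcases le_or_gt 0 (ε - η) with he | he
  · have h1 : 0 ≤ (ε - η) * (A - m) := mul_nonneg he (by linarith)
    have h2 : 0 ≤ (ε - η) * b := mul_nonneg he hb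
    have h3 : 0 ≤ (2 * ε - α) * (m - ε) := mul_nonneg (by linarith) (by linarith)
    have h4 : 0 ≤ (ε - η) * η := mul_nonneg he hη.le
    have h5 : 0 ≤ η * (1 - (m - ε)) := mul_nonneg hη.le (by linarith)
    have h6 : 0 ≤ η * (C - 3) := mul_nonneg hη.le (by linarith)
    nlinarith
  -- For e < 0 we have |e| ≤ η and α < 2η, so the left side is at least -(2(K + 1) + B)η and the
  -- right side at most (2 - C)η.
  · have h1 : 0 ≤ (η - ε) * (K + 1 - (A - (ε - η))) := mul_nonneg (by linarith) (by linarith)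
    have h2 : 0 ≤ (η - ε) * (B - b) := mul_nonneg (by linarith) (by linarith)
    have h3 : 0 ≤ ε * (2 * (K + 1) + B) := mul_nonneg (by linarith) (by linarith)
    have h4 : 0 ≤ (2 * η - α) * (m - ε) := mul_nonneg (by linarith) (by linarith)
    have h5 : 0 ≤ η * (1 - (m - ε)) := mul_nonneg hη.le (by linarith)
    have h6 : 0 ≤ η * (C - (2 * (K + 1) + B + 3)) := mul_nonneg hη.le (by linarith)
    nlinarith

variable {n : ℕ} {T : EReal} {X ν : ℝ → Sph n → Ambient n}

/-- At a first failure of strict pinching, the pinching function satisfies a differential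
inequality. -/
theorem first_failure_speed (h : ImmersedFamily T X ν) (hn : 1 ≤ n)
    (hpos : ∀ t ∈ timeInterval T, ∀ x, 0 < meanCurv (X t) (ν t) x)
    (hflow : ∀ t ∈ timeInterval T, ∀ x,
      HasDerivWithinAt (fun s => X s x) ((1 / meanCurv (X t) (ν t) x) • ν t x) (timeInterval T) t)
    {e : ℝ → ℝ} {e' t₀ : ℝ} (ht₀ : t₀ ∈ timeInterval T) (ht₀' : 0 < t₀)
    (he : HasDerivAt e e' t₀) {x₀ : Sph n}
    (hfail : ¬ StrictlyPinchedAt (X t₀) (ν t₀) (e t₀) x₀)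
    (hbefore : ∀ s, 0 ≤ s → s < t₀ → ∀ x, StrictlyPinchedAt (X s) (ν s) (e s) x) :
    ∃ A b : ℝ, 1 / n ≤ A ∧ (|e t₀| ≤ 1 → A ≤ (n + 2) ^ 2) ∧ 0 ≤ b ∧
      b ≤ 2 * n * ‖derivWithin (fun s => ν s x₀) (timeInterval T) t₀‖ ^ 2 ∧
      2 * e t₀ * (A - e t₀) + e t₀ * b ≤ e' := by
  obtain ⟨σ, U, hσ, h0, hσ0, hgraph⟩ := exists_graph_param h ht₀ x₀
  have D := graphFlow_of_param h hσ hpos hflow h0 ht₀ ht₀' hgraph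
  set F : ℝ × Model n → Ambient n := fun z => X z.1 (σ z.2) with hF
  set N : ℝ × Model n → Ambient n := fun z => ν z.1 (σ z.2) with hN
  set H : ℝ × Model n → ℝ := fun z => meanCurv (X z.1) (ν z.1) (σ z.2) with hH
  have hsub : {t : ℝ | 0 < t ∧ (t : EReal) < T} ×ˢ U ⊆ timeInterval T ×ˢ U :=
    Set.prod_mono openTimeInterval_subset subset_rfl
  have hform : ∀ z ∈ {t : ℝ | 0 < t ∧ (t : EReal) < T} ×ˢ U, ∀ r a,
      GraphFlow.pinchForm F N H r a a z = paramPinch X ν σ r z a := fun z hz r a => by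
    have h1 : dd (0, a) F z = tangentMap X σ z a :=
      (fderiv_slice_eq_dd (D.smoothF.diffAt_of_isOpen D.isOpen hz) a).symm
    have h2 : dd (0, a) N z = tangentMap ν σ z a :=
      (fderiv_slice_eq_dd (D.smoothN.diffAt_of_isOpen D.isOpen hz) a).symm
    rw [GraphFlow.pinchForm, ← D.sff_eq _ _ _ hz, h1, h2, paramPinch]
    ring
  have hlt : ∀ z ∈ {t : ℝ | 0 < t ∧ (t : EReal) < T} ×ˢ U, z.1 < t₀ → ∀ a,
      0 ≤ GraphFlow.pinchForm F N H (e z.1) a a z := fun z hz hzt a => by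
    rw [hform z hz]
    rcases eq_or_ne a 0 with rfl | ha
    · simp [paramPinch]
    · exact ((strictlyPinchedAt_iff h hσ (hsub hz) _).1
        (hbefore z.1 hz.1.1.le hzt (σ z.2)) a ha).le
  have hS : ∀ z ∈ {t : ℝ | 0 < t ∧ (t : EReal) < T} ×ˢ U, z.1 ≤ t₀ → ∀ a,
      0 ≤ GraphFlow.pinchForm F N H (e z.1) a a z := fun z hz hzt a => by
    rcases hzt.lt_or_eq with hzt | hzt
    · exact hlt z hz hzt a
    · obtain ⟨t, y⟩ := z
      obtain rfl : t = t₀ := hzt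
      have hg : ∀ g : ℝ × Model n → ℝ, ContDiffOn ℝ ∞ g ({t : ℝ | 0 < t ∧ (t : EReal) < T} ×ˢ U) →
          ContinuousAt (fun s => g (s, y)) t := fun g hg =>
        (hasDerivAt_time_dd (hg.diffAt_of_isOpen D.isOpen hz)).continuousAt
      have hc : ContinuousAt (fun s => GraphFlow.pinchForm F N H (e s) a a (s, y)) t :=
        (hg _ (D.smooth_sff a a)).sub
          (he.continuousAt.mul ((hg _ D.smoothH).mul (hg _ (D.smooth_metric a a))))
      -- At t₀ itself nonnegativity is the limit of strict pinching at earlier times.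
      refine ge_of_tendsto (hc.tendsto.mono_left nhdsWithin_le_nhds : Filter.Tendsto _ (𝓝[<] t) _) ?_
      have ho : ∀ᶠ s in 𝓝[<] t, s ∈ {t : ℝ | 0 < t ∧ (t : EReal) < T} :=
        nhdsWithin_le_nhds (isOpen_openTimeInterval.mem_nhds hz.1)
      filter_upwards [ho, self_mem_nhdsWithin] with s hs hst
      exact hlt (s, y) ⟨hs, hz.2⟩ hst a
  have hfail' : ¬ ∀ a, a ≠ 0 → 0 < paramPinch X ν σ (e t₀) (t₀, 0) a := by
    rw [← strictlyPinchedAt_iff h hσ (hsub D.mem)]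
    simpa only [hσ0] using hfail
  push Not at hfail'
  obtain ⟨a, ha, hle⟩ := hfail'
  have hna : ‖a‖ ≠ 0 := norm_ne_zero_iff.2 ha
  have hw1 : ⟪‖a‖⁻¹ • a, ‖a‖⁻¹ • a⟫ = (1 : ℝ) := by
    rw [real_inner_self_eq_norm_sq, norm_smul]; simp [hna]
  have hw : GraphFlow.pinchForm F N H (e t₀) (‖a‖⁻¹ • a) (‖a‖⁻¹ • a) (t₀, 0) = 0 := by
    refine le_antisymm ?_ (hS _ D.mem le_rfl _)
    rw [hform _ D.mem, paramPinch_smul]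
    exact mul_nonpos_of_nonneg_of_nonpos (by positivity) hle
  have hNd : dd (1, 0) N (t₀, 0) = derivWithin (fun s => ν s x₀) (timeInterval T) t₀ := by
    have h1 := hasDerivAt_time_dd (D.smoothN.diffAt_of_isOpen D.isOpen D.mem)
    rw [derivWithin_of_mem_nhds (timeInterval_mem_nhds ht₀ ht₀')]
    simp only [hN, hσ0] at h1
    exact h1.deriv.symm
  rw [← hNd]
  exact D.pinching_speed hn he hS hw1 hw

/-- Pinching is preserved by smooth inverse mean curvature flow of closed hypersurfaces, with an
improving constant. -/
theorem pinched_of_flow (h : ImmersedFamily T X ν) (hT : 0 < T) (hn : 1 ≤ n) {α : ℝ} (hα₀ : 0 ≤ α)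
    (hα₁ : α / 2 ≤ 1 / (n : ℝ))
    (hne : ∀ t ∈ timeInterval T, ∀ x, meanCurv (X t) (ν t) x ≠ 0)
    (hflow : ∀ t ∈ timeInterval T, ∀ x,
      HasDerivWithinAt (fun s => X s x) ((1 / meanCurv (X t) (ν t) x) • ν t x) (timeInterval T) t)
    (hH0 : ∀ x, 0 < meanCurv (X 0) (ν 0) x) (hP0 : Pinched (X 0) (ν 0) (α / 2)) {t₁ : ℝ}
    (ht₁ : t₁ ∈ timeInterval T) : Pinched (X t₁) (ν t₁) (pinchFun n α t₁) := by
  have hpos := meanCurv_pos h hT hne hH0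
  obtain ⟨C₀, hC₀⟩ := exists_bound_deriv_normal h hT ht₁
  set B : ℝ := 2 * n * C₀ ^ 2 with hB
  set C : ℝ := 2 * (((n : ℝ) + 2) ^ 2 + 1) + B + 3 with hC
  have hC0 : 0 ≤ C := by positivity
  have hz : (0 : ℝ) ∈ timeInterval T := ⟨le_rfl, by exact_mod_cast hT⟩
  have hstrict : ∀ δ : ℝ, 0 < δ → δ * Real.exp (C * t₁) ≤ 1 → ∀ x,
      StrictlyPinchedAt (X t₁) (ν t₁) (pinchFun n α t₁ - δ * Real.exp (C * t₁)) x := by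
    intro δ hδ hδ1 x
    by_contra hx
    set e : ℝ → ℝ := fun t => pinchFun n α t - δ * Real.exp (C * t) with he
    have hd : ∀ t, HasDerivAt e (α * (1 / n - pinchFun n α t) - C * (δ * Real.exp (C * t))) t :=
      fun t => by
      have h1 : HasDerivAt (fun t => Real.exp (C * t)) (Real.exp (C * t) * C) t := by
        simpa using ((hasDerivAt_id t).const_mul C).exp
      refine ((hasDerivAt_pinchFun n α t).sub (h1.const_mul δ)).congr_deriv ?_
      ring
    have hec : Continuous e := continuous_iff_continuousAt.2 fun t => (hd t).continuousAt
    obtain ⟨t₀, ht₀, x₀, hfail, hbefore⟩ := exists_first_failure h hT hec ht₁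
      (t := t₁) ⟨ht₁.1, le_rfl⟩ hx
    have ht₀T : t₀ ∈ timeInterval T := ⟨ht₀.1, lt_of_le_of_lt (by exact_mod_cast ht₀.2) ht₁.2⟩
    have ht₀pos : 0 < t₀ := by
      rcases ht₀.1.lt_or_eq with h0 | h0
      · exact h0
      -- At t = 0 the perturbation makes the assumed weak pinching strict, so the first failure is
      -- later.
      · exfalso
        subst h0
        refine hfail fun v hv => lt_of_lt_of_le ?_ (hP0 x₀ v)
        refine mul_lt_mul_of_pos_right (mul_lt_mul_of_pos_right ?_ (hH0 x₀))
          (firstForm_pos (h.immersion 0 hz x₀) hv)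
        simp only [he, pinchFun, mul_zero, Real.exp_zero]
        linarith
    obtain ⟨A, b, hA, hA', hb, hb', hODE⟩ :=
      first_failure_speed h hn hpos hflow ht₀T ht₀pos (hd t₀) hfail hbefore
    obtain ⟨hε₀, hε₁⟩ := pinchFun_bounds (n := n) hα₀ hα₁ ht₀.1
    have hη : 0 < δ * Real.exp (C * t₀) := by positivity
    have hη₁ : δ * Real.exp (C * t₀) ≤ 1 := by
      refine le_trans (mul_le_mul_of_nonneg_left (Real.exp_le_exp.2 ?_) hδ.le) hδ1
      exact mul_le_mul_of_nonneg_left ht₀.2 hC0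
    have hn1 : 1 / (n : ℝ) ≤ 1 := by
      rw [div_le_one (by positivity)]; exact_mod_cast hn
    have he1 : |e t₀| ≤ 1 := by
      rw [abs_le]
      constructor <;> simp only [he] <;> linarith
    refine barrier_contradiction hn hα₀ hε₀ hε₁ hη hA (hA' he1) hη₁ hb (hb'.trans ?_) le_rfl hODE
    exact mul_le_mul_of_nonneg_left (pow_le_pow_left₀ (norm_nonneg _) (hC₀ t₀ ht₀ x₀) 2)
      (by positivity)
  intro x v
  rcases eq_or_ne v 0 with rfl | hv
  · simp [firstForm, secondForm]
  have hlim : Filter.Tendsto (fun δ : ℝ => (pinchFun n α t₁ - δ * Real.exp (C * t₁)) *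
      meanCurv (X t₁) (ν t₁) x * firstForm (X t₁) x v v) (𝓝[>] 0)
      (𝓝 ((pinchFun n α t₁ - 0 * Real.exp (C * t₁)) *
      meanCurv (X t₁) (ν t₁) x * firstForm (X t₁) x v v)) :=
    (Continuous.tendsto (by fun_prop) 0).mono_left nhdsWithin_le_nhds
  rw [zero_mul, sub_zero] at hlim
  -- Here δ → 0; `C` depends on t₁ but not on δ.
  refine le_of_tendsto hlim ?_
  have hsmall : ∀ᶠ δ : ℝ in 𝓝[>] 0, δ * Real.exp (C * t₁) < 1 := by
    have h1 : Filter.Tendsto (fun δ : ℝ => δ * Real.exp (C * t₁)) (𝓝 0)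
        (𝓝 (0 * Real.exp (C * t₁))) := Continuous.tendsto (by fun_prop) 0
    rw [zero_mul] at h1
    exact nhdsWithin_le_nhds (h1.eventually (gt_mem_nhds one_pos))
  filter_upwards [hsmall, self_mem_nhdsWithin] with δ h1 h2
  exact (hstrict δ h2 h1.le x v hv).le

/-! ### Behaviour under homotheties -/

section Scaling

variable {Y μ : Sph n → Ambient n}

theorem diff_const_smul (hY : MDifferentiable (𝓡 n) 𝓘(ℝ, Ambient n) Y) (c : ℝ) (x : Sph n)
    (v : Tan x) : diff (fun x => c • Y x) x v = c • diff Y x v := by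
  have h1 : HasMFDerivAt (𝓡 n) 𝓘(ℝ, Ambient n) (fun x => c • Y x) x
      (c • (mfderiv (𝓡 n) 𝓘(ℝ, Ambient n) Y x : Tan x →L[ℝ] Ambient n)) :=
    (hY x).hasMFDerivAt.const_smul c
  have h2 := h1.mfderiv
  simp only [diff, mvfderiv]
  rw [h2]
  rfl

theorem matrix_inv_smul {ι : Type*} [Fintype ι] [DecidableEq ι] {k : ℝ} (hk : k ≠ 0)
    (M : Matrix ι ι ℝ) : (k • M)⁻¹ = k⁻¹ • M⁻¹ := by
  by_cases h : IsUnit M.det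
  · have := invertibleOfNonzero hk
    rw [Matrix.inv_smul _ k h, invOf_eq_inv]
  -- The inverse of a singular matrix is zero by convention, so the formula persists.
  · have h' : ¬ IsUnit (k • M).det := by
      rw [Matrix.det_smul]
      intro h2
      exact h (isUnit_of_mul_isUnit_right h2)
    rw [Matrix.nonsing_inv_apply_not_isUnit _ h, Matrix.nonsing_inv_apply_not_isUnit _ h',
      smul_zero]

/-- The normal is unchanged by the homothety, so g scales by c², h by c and H by c⁻¹. -/
theorem meanCurv_const_smul (hY : MDifferentiable (𝓡 n) 𝓘(ℝ, Ambient n) Y) {c : ℝ} (hc : 0 < c)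
    (x : Sph n) : meanCurv (fun x => c • Y x) μ x = c⁻¹ * meanCurv Y μ x := by
  have hg : gMatrix (fun x => c • Y x) x = c ^ 2 • gMatrix Y x := by
    ext i j
    simp only [gMatrix, firstForm, Matrix.of_apply, Matrix.smul_apply, diff_const_smul hY,
      real_inner_smul_left, real_inner_smul_right, smul_eq_mul]
    ring
  have hh : hMatrix (fun x => c • Y x) μ x = c • hMatrix Y μ x := by
    ext i j
    simp only [hMatrix, secondForm, Matrix.of_apply, Matrix.smul_apply, diff_const_smul hY,
      real_inner_smul_right, smul_eq_mul]
  simp only [meanCurv, hg, hh, matrix_inv_smul (pow_ne_zero 2 hc.ne'), Finset.mul_sum,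
    Matrix.smul_apply, smul_eq_mul]
  refine Finset.sum_congr rfl fun i _ => Finset.sum_congr rfl fun j _ => ?_
  field_simp

/-- The pinching condition is invariant under homotheties. -/
theorem pinched_const_smul (hY : MDifferentiable (𝓡 n) 𝓘(ℝ, Ambient n) Y) {c : ℝ} (hc : 0 < c)
    {ε : ℝ} (hP : Pinched Y μ ε) : Pinched (fun x => c • Y x) μ ε := by
  intro x v
  have h1 := mul_le_mul_of_nonneg_left (hP x v) hc.le
  rw [meanCurv_const_smul hY hc]
  simp only [firstForm, secondForm, diff_const_smul hY, real_inner_smul_left,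
    real_inner_smul_right] at h1 ⊢
  refine le_trans (le_of_eq ?_) h1
  field_simp

end Scaling

theorem IsHypersurfaceFamily.immersedFamily (h : IsHypersurfaceFamily T X ν) :
    ImmersedFamily T X ν :=
  ⟨h.smooth, h.smooth_normal, h.immersion, h.norm_normal, h.normal⟩

theorem ImmersedFamily.mdifferentiable (h : ImmersedFamily T X ν) {t : ℝ}
    (ht : t ∈ timeInterval T) : MDifferentiable (𝓡 n) 𝓘(ℝ, Ambient n) (X t) :=
  (contMDiff_slice h.smooth ht).mdifferentiable (by simp)

/-- Time dependent homotheties of a family of immersions. -/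
theorem ImmersedFamily.smul (h : ImmersedFamily T X ν) {c : ℝ → ℝ} (hc : ContDiff ℝ ∞ c)
    (hpos : ∀ t, 0 < c t) : ImmersedFamily T (fun t x => c t • X t x) ν where
  smooth := by
    have h1 : ContMDiff (𝓘(ℝ, ℝ).prod (𝓡 n)) 𝓘(ℝ, ℝ) ∞ (fun p : ℝ × Sph n => c p.1) :=
      hc.contMDiff.comp contMDiff_fst
    exact h1.contMDiffOn.smul h.smooth
  smooth_normal := h.smooth_normal
  immersion := fun t ht x v w hvw => by
    rw [diff_const_smul (h.mdifferentiable ht), diff_const_smul (h.mdifferentiable ht)] at hvw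
    exact h.immersion t ht x (smul_right_injective _ (hpos t).ne' hvw)
  norm_normal := h.norm_normal
  normal := fun t ht x v => by
    rw [diff_const_smul (h.mdifferentiable ht), real_inner_smul_right, h.normal t ht, mul_zero]

end IMCF

end

theorem theorem3p7 (n : ℕ) (hn : 1 ≤ n) (α : ℝ) (hα₀ : 0 ≤ α) (hα₁ : α / 2 ≤ 1 / (n : ℝ))
    (T : EReal) (hT : 0 < T) :
    (∀ X ν : ℝ → IMCF.Sph n → IMCF.Ambient n, IMCF.IsSolution T X ν →
      (∀ x, 0 < IMCF.meanCurv (X 0) (ν 0) x) → IMCF.Pinched (X 0) (ν 0) (α / 2) →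
      ∀ t ∈ IMCF.timeInterval T,
        IMCF.Pinched (X t) (ν t) (IMCF.pinchFun n α t) ∧
        IMCF.Pinched (IMCF.rescale X t) (ν t) (IMCF.pinchFun n α t)) ∧
    (∀ X ν : ℝ → IMCF.Sph n → IMCF.Ambient n, IMCF.IsRescaledSolution T X ν →
      (∀ x, 0 < IMCF.meanCurv (X 0) (ν 0) x) → IMCF.Pinched (X 0) (ν 0) (α / 2) →
      ∀ t ∈ IMCF.timeInterval T, IMCF.Pinched (X t) (ν t) (IMCF.pinchFun n α t)) := by
  constructor
  · intro X ν h hH hP t ht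
    have hI := h.toIsHypersurfaceFamily.immersedFamily
    have h1 := IMCF.pinched_of_flow hI hT hn hα₀ hα₁ h.meanCurv_ne_zero h.flow hH hP ht
    exact ⟨h1, IMCF.pinched_const_smul (hI.mdifferentiable ht) (Real.exp_pos _) h1⟩
  · intro X ν h hH hP t ht
    have hI := h.toIsHypersurfaceFamily.immersedFamily
    -- Multiplying by e^{t/n} cancels the term -X/n, and the speed 1/H scales by the same factor, so
    -- the product solves the unrescaled flow.
    have hcd : ContDiff ℝ ∞ fun t : ℝ => Real.exp (t / n) := by fun_prop
    have hJ := hI.smul hcd fun t => Real.exp_pos _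
    have hmc : ∀ t ∈ IMCF.timeInterval T, ∀ x,
        IMCF.meanCurv (fun x => Real.exp (t / n) • X t x) (ν t) x =
          (Real.exp (t / n))⁻¹ * IMCF.meanCurv (X t) (ν t) x := fun t ht x =>
      IMCF.meanCurv_const_smul (hI.mdifferentiable ht) (Real.exp_pos _) x
    have hz : (0 : ℝ) ∈ IMCF.timeInterval T := ⟨le_rfl, by exact_mod_cast hT⟩
    have h1 := IMCF.pinched_of_flow hJ hT hn hα₀ hα₁
      (fun t ht x => by
        rw [hmc t ht]
        exact mul_ne_zero (inv_ne_zero (Real.exp_ne_zero _)) (h.meanCurv_ne_zero t ht x))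
      (fun t ht x => by
        have h2 : HasDerivWithinAt (fun s : ℝ => Real.exp (s / n)) (Real.exp (t / n) * (1 / n))
            (IMCF.timeInterval T) t := ((hasDerivAt_id t).div_const (n : ℝ)).exp.hasDerivWithinAt
        refine (h2.smul (h.flow t ht x)).congr_deriv ?_
        have h3 := h.meanCurv_ne_zero t ht x
        rw [hmc t ht]
        simp only [smul_add, smul_smul, neg_smul, smul_neg]
        have h4 : 1 / ((Real.exp (t / n))⁻¹ * IMCF.meanCurv (X t) (ν t) x) =
            Real.exp (t / n) * (1 / IMCF.meanCurv (X t) (ν t) x) := by field_simp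
        rw [h4]
        abel)
      (fun x => by
        rw [hmc 0 hz]
        exact mul_pos (inv_pos.2 (Real.exp_pos _)) (hH x))
      (IMCF.pinched_const_smul (hI.mdifferentiable hz) (Real.exp_pos _) hP) ht
    have h2 := IMCF.pinched_const_smul (hJ.mdifferentiable ht) (inv_pos.2 (Real.exp_pos (t / n))) h1
    simpa only [inv_smul_smul₀ (Real.exp_ne_zero _)] using h2
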